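/- Let $P=\{x\in\mathbb R^n:\ \ell_r(x)=\langle x,\nu_r\rangle+\lambda_r\ge 0,\ r=1,\dots,d\}$ be a Delzant polytope with primitive inward normals $\nu_r\in\mathbb Z^n$ of its facets and half-integral constants $\lambda_r=\lambda^L_r+\tfrac12$, $\lambda^L_r\in\mathbb Z$. Let $(M,\omega)$ be the associated compact symplectic toric manifold, $D_r$ the divisor over the facet $\ell_r=0$, and $L=\mathcal O(\sum_r\lambda^L_rD_r)$. On the open orbit $\mathring M=\mathring P\times T^n$, with action-angle coordinates $(x,\theta)$ and $\omega=\sum_j dx_j\wedge d\theta_j$, put $$g_P=\tfrac12\sum_r\ell_r\log\ell_r,\quad y_j=\frac{\partial g_P}{\partial x_j},\quad z_j=y_j+i\theta_j,\quad w_j=e^{z_j},\quad k=x\cdot y-g_P,\quad dZ=dz_1\wedge\dots\wedge dz_n .$$ Let $\mathbf 1$ be the unitary frame over $\mathring M$ with $\nabla\mathbf 1=-i\sum_jx_j\,d\theta_j\,\mathbf 1$; $L$ is trivialized over $\mathring M$ by $\mathbf 1\otimes\sqrt{dZ}$. For $m\in P\cap\mathbb Z^n$ let $\sigma_0^m=w^me^{-k}\,\mathbf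 1\otimes\sqrt{dZ}$. Let $0\le p\le n$ and $H=\frac12\sum_{j=1}^px_j^2$. For a function $f$ let $X_f$ be its Hamiltonian vector field ($\iota_{X_f}\omega=df$) and $\hat f^{prQ}=f+i\nabla_{X_f}$ the Kostant–Souriau operator. Let $\hat H^Q=\frac12\sum_{j=1}^p(\hat x_j^{prQ})^2$, acting on the coefficient of a section with respect to the half-form. For $s\ge0$ let $$U_s=\big(e^{s\hat H^{prQ}}\otimes e^{is\mathcal L_{X_H}}\big)\circ e^{-s\hat H^Q},$$ where the exponentials are given by their power series and $e^{is\mathcal L_{X_H}}\sqrt{\alpha}=\sqrt{e^{is\mathcal L_{X_H}}\alpha}$ for $n$-forms $\alpha$. Half-forms are paired by $\langle\sqrt\alpha,\sqrt\beta\rangle=\sqrt{\langle\alpha,\beta\rangle}$, where $\langle\alpha,\beta\rangle=\alpha\wedge\bar\beta\,/\big((2i)^n(-1)^{n(n+1)/2}\omega^n/n!\big)$. A half-form valued section $f\,\mathbf 1\otimes\sqrt\alpha$ on $\mathring M$ acts as a distributional section on a smooth section of $L$ over $M$, written on $\mathring M$ as $\tau\,\mathbf 1\otimes\sqrt{dZ}/\|\sqrt{dZ}\|$,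 by $$\int_{\mathring M}f\,\bar\tau\,\frac{\langle\sqrt\alpha,\sqrt{dZ}\rangle}{\|\sqrt{dZ}\|}\,\frac{\omega^n}{n!}.$$ Then, for every $m\in P\cap\mathbb Z^n$: on $\mathring M$, $\hat H^Q\sigma_0^m=H(m)\sigma_0^m$; for every $s\ge0$ the series defining $U_s\sigma_0^m$ converge on $\mathring M$, and $U_s\sigma_0^m$ is a distributional section over $M$ (all the integrals converge and are bounded by a constant times the supremum norm of the test section); so is $$\tilde\sigma^m_\infty=\sqrt{2\pi}^{\,p}\ \delta(x_1-m_1)\cdots\delta(x_p-m_p)\ W^m\ \sqrt{dx_1\wedge\dots\wedge dx_p\wedge dz_{p+1}\wedge\dots\wedge dz_n},$$ $$W^m=e^{-k}\,w_{p+1}^{m_{p+1}}\cdots w_n^{m_n}\,e^{i\sum_{j\le p}m_j\theta_j}\,e^{\sum_{j\le p}m_jy_j};$$ and $$\lim_{s\to+\infty}U_s\sigma_0^m=\tilde\sigma_\infty^m ,$$ in the sense that the pairings with each smooth section of $L$ over $M$ converge and that $s^{-p}e^{is\mathcal L_{X_H}}dZ\to dx_1\wedge\dots\wedge dx_p\wedge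 dz_{p+1}\wedge\dots\wedge dz_n$ locally uniformly on $\mathring M$. -/

import Mathlib

open scoped ContDiff

noncomputable section

/-- Points `(x, θ)` of `ℝⁿ × ℝⁿ`, used as action-angle coordinates.  The angles `θ` are coordinates
on the universal cover of `Tⁿ = ℝⁿ / (2π ℤ)ⁿ`. -/
abbrev Phase (n : ℕ) : Type := (Fin n → ℝ) × (Fin n → ℝ)

/-- Complex-valued `ℝ`-multilinear alternating `n`-forms at a point. -/
abbrev NForm (n : ℕ) : Type := (Phase n) [⋀^Fin n]→L[ℝ] ℂ

/-- The coordinate vector field `∂/∂xʲ`. -/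
def ddx {n : ℕ} (j : Fin n) : Phase n := (Pi.single j 1, 0)

/-- The coordinate vector field `∂/∂θʲ`. -/
def ddθ {n : ℕ} (j : Fin n) : Phase n := (0, Pi.single j 1)

/-- A Delzant polytope `P = {x | ℓ_r(x) = ⟨x, ν_r⟩ + λ_r ≥ 0}` with integral normals `ν_r` and
half-integral constants `λ_r = λ^L_r + 1/2`, `λ^L_r ∈ ℤ`.  The line bundle of the half-form
corrected quantization of the associated toric manifold is `L = 𝒪(∑ λ^L_r D_r)`. -/
structure DelzantPolytope (n d : ℕ) where
  /-- the inward pointing normals of the facets -/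
  ν : Fin d → Fin n → ℤ
  /-- the integers `λ^L_r` -/
  lamL : Fin d → ℤ
  /-- `P` is bounded -/
  bounded : Bornology.IsBounded
    {x : Fin n → ℝ | ∀ r, 0 ≤ (∑ j, x j * (ν r j : ℝ)) + ((lamL r : ℝ) + 1 / 2)}
  /-- `P` has non-empty interior -/
  full : ∃ x : Fin n → ℝ, ∀ r, 0 < (∑ j, x j * (ν r j : ℝ)) + ((lamL r : ℝ) + 1 / 2)
  /-- every inequality defines a facet, and different ones define different facets -/
  facet : ∀ r, ∃ x : Fin n → ℝ,
    (∑ j, x j * (ν r j : ℝ)) + ((lamL r : ℝ) + 1 / 2) = 0 ∧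
    ∀ r', r' ≠ r → 0 < (∑ j, x j * (ν r' j : ℝ)) + ((lamL r' : ℝ) + 1 / 2)
  /-- at each point of `P` the normals of the facets through it are part of a `ℤ`-basis of `ℤⁿ` -/
  delzant : ∀ x : Fin n → ℝ,
    (∀ r, 0 ≤ (∑ j, x j * (ν r j : ℝ)) + ((lamL r : ℝ) + 1 / 2)) →
    ∃ b : Module.Basis (Fin n) ℤ (Fin n → ℤ),
      ∀ r, (∑ j, x j * (ν r j : ℝ)) + ((lamL r : ℝ) + 1 / 2) = 0 → ν r ∈ Set.range b

/-! ### Prequantization in action-angle coordinates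

On `P° × Tⁿ` with `ω = ∑ dxʲ ∧ dθʲ`, sections of the prequantum bundle `ℓ` are written as
`f 𝟏` with a unitary frame `𝟏` such that `∇𝟏 = -i ∑ xⱼ dθʲ 𝟏`; the section is represented by its
coefficient `f`. -/

/-- The Hamiltonian vector field `X_f`, with `ι_{X_f} ω = df` for `ω = ∑ dxʲ ∧ dθʲ`. -/
def hamVF {n : ℕ} (f : Phase n → ℝ) (q : Phase n) : Phase n :=
  (fun j => fderiv ℝ f q (ddθ j), fun j => -fderiv ℝ f q (ddx j))

/-- Covariant derivative along a vector field, for the connection `d - i ∑ xⱼ dθʲ`. -/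
def covDeriv {n : ℕ} (X : Phase n → Phase n) (f : Phase n → ℂ) (q : Phase n) : ℂ :=
  fderiv ℝ f q (X q) - Complex.I * ((∑ j, q.1 j * (X q).2 j : ℝ) : ℂ) * f q

/-- The Kostant-Souriau prequantum operator `f + i ∇_{X_f}`. -/
def prequantumOp {n : ℕ} (f : Phase n → ℝ) (ψ : Phase n → ℂ) (q : Phase n) : ℂ :=
  (f q : ℂ) * ψ q + Complex.I * covDeriv (hamVF f) ψ q

/-- The Hamiltonian `H = ½ ∑_{j ≤ p} xⱼ²` as a function of the action coordinates. -/
def hamiltonian {n : ℕ} (p : ℕ) (x : Fin n → ℝ) : ℝ :=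
  (1 / 2) * ∑ j : Fin n, if j.val < p then x j ^ 2 else 0

/-- The quantum operator `Ĥ^Q = ½ ∑_{j ≤ p} (x̂ⱼ^{prQ})²`. -/
def quantumOp {n : ℕ} (p : ℕ) (ψ : Phase n → ℂ) (q : Phase n) : ℂ :=
  (1 / 2) * ∑ j : Fin n, if j.val < p then
    prequantumOp (fun q' => q'.1 j) (prequantumOp (fun q' => q'.1 j) ψ) q else 0

/-- The Lie derivative `L_X α = d/dt|₀ φ_t^* α`, with `φ_t(q) = q + t X(q)`, a curve of local
diffeomorphisms with velocity `X` at `t = 0`. -/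
def lieDeriv {n : ℕ} (X : Phase n → Phase n) (α : Phase n → NForm n) (q : Phase n) :
    NForm n :=
  deriv (fun t : ℝ => (α (q + t • X q)).compContinuousLinearMap
    (ContinuousLinearMap.id ℝ (Phase n) + t • fderiv ℝ X q)) 0

/-- The `k`-th term at `q` of the exponential series of `c • A` applied to `ψ`. -/
def expTerm {n : ℕ} {V : Type*} [AddCommGroup V] [Module ℂ V]
    (A : (Phase n → V) → Phase n → V) (c : ℂ) (ψ : Phase n → V) (q : Phase n) (k : ℕ) : V :=
  (c ^ k / (k.factorial : ℂ)) • (A^[k] ψ) q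

/-- The operator `e^{cA}`, given by the pointwise exponential series. -/
def expOp {n : ℕ} {V : Type*} [AddCommGroup V] [Module ℂ V] [TopologicalSpace V]
    (A : (Phase n → V) → Phase n → V) (c : ℂ) (ψ : Phase n → V) (q : Phase n) : V :=
  ∑' k, expTerm A c ψ q k

/-! ### Half-forms -/

/-- A half-form valued section `f 𝟏 ⊗ √α`. -/
structure HalfFormSection (n : ℕ) where
  /-- the coefficient `f` -/
  coeff : Phase n → ℂ
  /-- the `n`-form `α` under the square root -/
  form : Phase n → NForm n

/-- The wedge product `η₁ ∧ ⋯ ∧ ηₙ` of complex valued one-forms, `v ↦ det (ηᵢ(vⱼ))`. -/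
def wedgeOne {n : ℕ} (η : Fin n → Phase n →L[ℝ] ℂ) : NForm n where
  toFun v := Matrix.detRowAlternating (R := ℂ) (fun i j => η j (v i))
  map_update_add' v i a b := by
    have h : ∀ c, (fun k j => η j (Function.update v i c k)) =
        Function.update (fun k j => η j (v k)) i (fun j => η j c) := by
      intro c
      funext k
      by_cases hk : k = i
      · subst hk; simp
      · simp [Function.update_of_ne hk]
    simp only [h]
    rw [← AlternatingMap.map_update_add]
    congr 2
    funext j
    simp
  map_update_smul' v i c a := by
    have h : ∀ c, (fun k j => η j (Function.update v i c k)) =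
        Function.update (fun k j => η j (v k)) i (fun j => η j c) := by
      intro c
      funext k
      by_cases hk : k = i
      · subst hk; simp
      · simp [Function.update_of_ne hk]
    simp only [h]
    have := (Matrix.detRowAlternating (R := ℂ)).map_update_smul
      (fun k j => η j (v k)) i (c : ℂ) (fun j => η j a)
    rw [Complex.real_smul, ← smul_eq_mul]
    convert this using 3
    · funext j
      simp
    · congr!
  map_eq_zero_of_eq' v i j h hij :=
    (Matrix.detRowAlternating (R := ℂ)).map_eq_zero_of_eq _ (by simp [h]) hij
  cont := by
    change Continuous fun v : Fin n → Phase n => Matrix.det (Matrix.of fun i j => η j (v i))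
    refine Continuous.matrix_det (continuous_matrix fun i j => ?_)
    exact (η j).continuous.comp (continuous_apply i)

/-- The value of the `2n`-form `α ∧ β̄` on `2n` vectors. -/
def wedgeConj {n : ℕ} (α β : NForm n) (v : Fin n ⊕ Fin n → Phase n) : ℂ :=
  (1 / ((n.factorial : ℂ) * (n.factorial : ℂ))) * ∑ σ : Equiv.Perm (Fin n ⊕ Fin n),
    ((Equiv.Perm.sign σ : ℤ) : ℂ) * (α (fun i => v (σ (Sum.inl i))) *
      (starRingEnd ℂ) (β (fun i => v (σ (Sum.inr i)))))

/-- The sesquilinear pairing `⟨α, β⟩ = α ∧ β̄ / ((2i)ⁿ (-1)^{n(n+1)/2} ωⁿ/n!)`, computed on the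
frame `(∂/∂x¹, …, ∂/∂xⁿ, ∂/∂θ¹, …, ∂/∂θⁿ)`, on which `ωⁿ/n!` takes the value
`(-1)^{n(n-1)/2}`.  For `β = α` it is the metric of the canonical bundle. -/
def formPairing {n : ℕ} (α β : NForm n) : ℂ :=
  wedgeConj α β (Sum.elim ddx ddθ) /
    ((2 * Complex.I) ^ n * (-1) ^ (n * (n + 1) / 2) * (-1) ^ (n * (n - 1) / 2))

/-- The induced (Blattner-Kostant-Sternberg) pairing `⟨√α, √β⟩ = √⟨α, β⟩` of half-forms, which
compares half-forms of different polarizations.  The principal branch is the one for which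
`⟨√β, √β⟩ > 0`. -/
def halfFormPairing {n : ℕ} (α β : NForm n) : ℂ :=
  formPairing α β ^ (1 / 2 : ℂ)

/-- The generalized coherent state transform
`U_s = (e^{s Ĥ^{prQ}} ⊗ e^{i s L_{X_H}}) ∘ e^{-s Ĥ^Q}`, where `e^{i s L_{X_H}} √α` is
`√(e^{i s L_{X_H}} α)`. -/
def gcst {n : ℕ} (p : ℕ) (s : ℝ) (σ : HalfFormSection n) : HalfFormSection n where
  coeff := expOp (prequantumOp fun q => hamiltonian p q.1) (s : ℂ)
    (expOp (quantumOp p) (-(s : ℂ)) σ.coeff)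
  form := expOp (lieDeriv (hamVF fun q => hamiltonian p q.1)) (Complex.I * (s : ℂ)) σ.form

/-- All exponential series in the definition of `U_s σ` converge on the set `S`. -/
def GCSTDefinedOn {n : ℕ} (S : Set (Phase n)) (p : ℕ) (s : ℝ) (σ : HalfFormSection n) : Prop :=
  ∀ q ∈ S,
    Summable (expTerm (quantumOp p) (-(s : ℂ)) σ.coeff q) ∧
    Summable (expTerm (prequantumOp fun q' => hamiltonian p q'.1) (s : ℂ)
      (expOp (quantumOp p) (-(s : ℂ)) σ.coeff) q) ∧
    Summable (expTerm (lieDeriv (hamVF fun q' => hamiltonian p q'.1)) (Complex.I * (s : ℂ))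
      σ.form q)

namespace DelzantPolytope

variable {n d : ℕ} (P : DelzantPolytope n d)

/-- The affine function `ℓ_r(x) = ⟨x, ν_r⟩ + λ^L_r + 1/2`. -/
def ell (r : Fin d) (x : Fin n → ℝ) : ℝ :=
  (∑ j, x j * (P.ν r j : ℝ)) + ((P.lamL r : ℝ) + 1 / 2)

/-- The polytope `P`. -/
def carrier : Set (Fin n → ℝ) := {x | ∀ r, 0 ≤ P.ell r x}

/-- The interior `P°`. -/
def inner : Set (Fin n → ℝ) := {x | ∀ r, 0 < P.ell r x}

/-- The open orbit `M° = P° × Tⁿ`, as a subset of `ℝⁿ × ℝⁿ` (invariant under `2πℤⁿ`). -/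
def openOrbit : Set (Phase n) := {q | q.1 ∈ P.inner}

/-- The fundamental domain `P° × [0, 2π)ⁿ` of the open orbit. -/
def fundDomain : Set (Phase n) :=
  {q | q.1 ∈ P.inner ∧ ∀ j, q.2 j ∈ Set.Ico 0 (2 * Real.pi)}

/-- The symplectic potential `g_P = ½ ∑ ℓ_r log ℓ_r`. -/
def potential (x : Fin n → ℝ) : ℝ := (1 / 2) * ∑ r, P.ell r x * Real.log (P.ell r x)

/-- `y_j = ∂g_P/∂xʲ`. -/
def y (j : Fin n) (x : Fin n → ℝ) : ℝ := fderiv ℝ P.potential x (Pi.single j 1)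

/-- `k(x) = x · ∂g_P/∂x - g_P(x)`. -/
def kahler (x : Fin n → ℝ) : ℝ := (∑ j, x j * P.y j x) - P.potential x

/-- The holomorphic coordinates `z_j = ∂g_P/∂xʲ + i θ_j`. -/
def z (j : Fin n) (q : Phase n) : ℂ := (P.y j q.1 : ℂ) + Complex.I * (q.2 j : ℂ)

/-- `w_j = e^{z_j}`. -/
def w (j : Fin n) (q : Phase n) : ℂ := Complex.exp (P.z j q)

/-- `dZ = dz_1 ∧ ⋯ ∧ dz_n`. -/
def dZ (q : Phase n) : NForm n := wedgeOne fun j => fderiv ℝ (P.z j) q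

/-- `dx_1 ∧ ⋯ ∧ dx_p ∧ dz_{p+1} ∧ ⋯ ∧ dz_n`. -/
def dXdZ (p : ℕ) (q : Phase n) : NForm n :=
  wedgeOne fun j => if j.val < p then fderiv ℝ (fun q' : Phase n => (q'.1 j : ℂ)) q
    else fderiv ℝ (P.z j) q

/-- The monomial section `σ^m_0 = w^m e^{-k} 𝟏 ⊗ √dZ`. -/
def monomialSection (m : Fin n → ℤ) : HalfFormSection n where
  coeff q := (∏ j, P.w j q ^ m j) * Complex.exp (-(P.kahler q.1 : ℂ))
  form := P.dZ

/-- `W^m ⊗ √(dx_1 ∧ ⋯ ∧ dx_p ∧ dz_{p+1} ∧ ⋯ ∧ dz_n)`, where `W^m` is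
`e^{-k} w_{p+1}^{m_{p+1}} ⋯ w_n^{m_n} e^{i ∑_{j ≤ p} m_j θ_j} e^{∑_{j ≤ p} m_j ∂g_P/∂x_j}`. -/
def limitDensity (p : ℕ) (m : Fin n → ℤ) : HalfFormSection n where
  coeff q := Complex.exp (-(P.kahler q.1 : ℂ)) *
    (∏ j : Fin n, if j.val < p then 1 else P.w j q ^ m j) *
    Complex.exp (Complex.I * ∑ j : Fin n, if j.val < p then (m j : ℂ) * (q.2 j : ℂ) else 0) *
    Complex.exp (∑ j : Fin n, if j.val < p then (m j : ℂ) * (P.y j q.1 : ℂ) else 0)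
  form := P.dXdZ p

/-! ### Test sections and distributional sections on the compact toric manifold

By Delzant's construction, the toric manifold is `M = Z/N` with
`Z = {z ∈ ℂᵈ | ∃ x ∈ P, ∀ r, |z_r|² = ℓ_r(x)}`, a compact submanifold of `ℂᵈ`, and `N` the kernel
of the map `Tᵈ → Tⁿ`, `(φ_r) ↦ ∑ φ_r ν_r`; the point of `Z` with `z_r = √ℓ_r(x) e^{iφ_r}`, `x ∈ P°`,
lies over the point `(x, ∑ φ_r ν_r)` of the open orbit. The line bundle
`L = 𝒪(∑ λ^L_r D_r)` is associated with the character `∏ t_r^{λ^L_r}` of `N`. Smooth sections of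
`L` are therefore the smooth functions `F` on `Z` with `F(t z) = ∏ t_r^{λ^L_r} F(z)` for `t ∈ N`.
Over the open orbit such a section is given by its coefficient with respect to the unitary frame
`𝟏 ⊗ √dZ/‖√dZ‖` of `L`. -/

/-- `τ` is, on the open orbit, the coefficient with respect to the unitary frame of `L` of a
section of `L` that is smooth on all of the compact toric manifold `M`. -/
def IsSmoothSection (τ : Phase n → ℂ) : Prop :=
  ∃ F : (Fin d → ℂ) → ℂ, ContDiff ℝ ∞ F ∧
    ∀ x ∈ P.inner, ∀ φ : Fin d → ℝ,
      F (fun r => (Real.sqrt (P.ell r x) : ℂ) * Complex.exp (Complex.I * (φ r : ℂ))) =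
        Complex.exp (Complex.I * ∑ r, (P.lamL r : ℂ) * (φ r : ℂ)) *
          τ (x, fun j => ∑ r, φ r * (P.ν r j : ℝ))

/-- The space of test sections: smooth sections of `L` over `M`. -/
def testSections : Submodule ℂ (Phase n → ℂ) where
  carrier := {τ | P.IsSmoothSection τ}
  add_mem' := by
    rintro τ τ' ⟨F, hF, h⟩ ⟨F', hF', h'⟩
    refine ⟨fun v => F v + F' v, hF.add hF', fun x hx φ => ?_⟩
    simp only [h x hx φ, h' x hx φ, Pi.add_apply, mul_add]
  zero_mem' := ⟨fun _ => 0, contDiff_const, fun x hx φ => by simp⟩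
  smul_mem' := by
    rintro c τ ⟨F, hF, h⟩
    refine ⟨fun v => c * F v, contDiff_const.mul hF, fun x hx φ => ?_⟩
    simp only [h x hx φ, Pi.smul_apply, smul_eq_mul]
    ring

/-- Distributional sections of `L` over `M` of order zero: antilinear functionals on the smooth
sections which are continuous (already for the supremum norm). -/
def IsDistributionalSection (T : P.testSections → ℂ) : Prop :=
  (∀ (c : ℂ) (τ τ' : P.testSections), T (c • τ + τ') = (starRingEnd ℂ) c * T τ + T τ') ∧
  ∃ C : ℝ, ∀ (τ : P.testSections) (c : ℝ), (∀ q ∈ P.openOrbit, ‖τ.1 q‖ ≤ c) → ‖T τ‖ ≤ C * c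

/-- The pointwise hermitian pairing of `σ = f 𝟏 ⊗ √α` with the section `τ 𝟏 ⊗ √dZ/‖√dZ‖`. -/
def pointPairing (σ : HalfFormSection n) (τ : Phase n → ℂ) (q : Phase n) : ℂ :=
  σ.coeff q * (starRingEnd ℂ) (τ q) *
    (halfFormPairing (σ.form q) (P.dZ q) /
      (Real.sqrt ‖halfFormPairing (P.dZ q) (P.dZ q)‖ : ℂ))

/-- The functional defined by a half-form valued section on the open orbit, by integration of the
pointwise pairing against the Liouville measure `ωⁿ/n! = dx dθ`. -/
def sectionFunctional (σ : HalfFormSection n) (τ : P.testSections) : ℂ :=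
  ∫ q in P.fundDomain, P.pointPairing σ τ.1 q

/-- The section `σ` defines a functional: all the integrals exist. -/
def SectionIntegrable (σ : HalfFormSection n) : Prop :=
  ∀ τ : P.testSections,
    MeasureTheory.IntegrableOn (P.pointPairing σ τ.1) P.fundDomain

/-- The point whose first `p` coordinates are those of `c` and whose remaining ones are `u`. -/
def glue (p : ℕ) (c : Fin n → ℝ) (u : {j : Fin n // p ≤ j.val} → ℝ) : Fin n → ℝ :=
  fun j => if h : p ≤ j.val then u ⟨j, h⟩ else c j

/-- The part of the fundamental domain where `x_j = c_j` for `j ≤ p`, parametrized by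
`(x_{p+1}, …, x_n)` and `θ`. -/
def sliceDomain (p : ℕ) (c : Fin n → ℝ) :
    Set (({j : Fin n // p ≤ j.val} → ℝ) × (Fin n → ℝ)) :=
  {v | (glue p c v.1, v.2) ∈ P.fundDomain}

/-- The functional defined by `δ(x_1 - c_1) ⋯ δ(x_p - c_p) σ`. -/
def deltaFunctional (p : ℕ) (c : Fin n → ℝ) (σ : HalfFormSection n) (τ : P.testSections) : ℂ :=
  ∫ v in P.sliceDomain p c, P.pointPairing σ τ.1 (glue p c v.1, v.2)

/-- The integrals defining `δ(x_1 - c_1) ⋯ δ(x_p - c_p) σ` exist. -/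
def DeltaIntegrable (p : ℕ) (c : Fin n → ℝ) (σ : HalfFormSection n) : Prop :=
  ∀ τ : P.testSections, MeasureTheory.IntegrableOn
    (fun v => P.pointPairing σ τ.1 (glue p c v.1, v.2)) (P.sliceDomain p c)

/-- The distributional section
`σ̃^m_∞ = √(2π)^p δ(x_1 - m_1) ⋯ δ(x_p - m_p) W^m √(dx_1 ∧ ⋯ ∧ dx_p ∧ dz_{p+1} ∧ ⋯ ∧ dz_n)`. -/
def limitFunctional (p : ℕ) (m : Fin n → ℤ) (τ : P.testSections) : ℂ :=
  (Real.sqrt (2 * Real.pi) ^ p : ℝ) *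
    P.deltaFunctional p (fun j => (m j : ℝ)) (P.limitDensity p m) τ

end DelzantPolytope

end

/-! On the open orbit everything is explicit. Write `G = ½ ∑ ν_r ν_rᵀ / ℓ_r` for the Hessian of the
symplectic potential, so that `dz_j = ∑ₖ G_{jk} dx_k + i dθ_j`.

*The transform.* The operators in `U_s` multiply the Fourier mode `f(x) e^{i m·θ}` by functions of
the actions: `Ĥ^Q` by `H(m)` and `Ĥ^{prQ}` by `-H(x) + ∑_{j ≤ p} x_j m_j`. Hence the coefficient of
`U_s σ^m` is that of `σ^m` times the Gaussian `e^{-s H(x - m)}` (`gcst_coeff`). The Hamiltonian flow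
of `H` at time `t` is the linear map `1 + t · shear`, which pulls `dZ` back to
`⋀_{j ≤ p} (dz_j - i t dx_j) ∧ ⋀_{j > p} dz_j`. This is entire in `t`, its derivatives at `0` are
the iterated Lie derivatives, and Taylor's theorem at `t = i s` gives `dz_j + s dx_j` for `j ≤ p`
(`hasSum_lieDeriv`). After division by `s^p` the form depends continuously on `(1/s, q)` up to
`1/s = 0`, whence the convergence of forms.

*Boundedness.* The pairing of `⋀ (c_j dz_j + e_j dx_j)` with `dZ` is
`2⁻ⁿ det (diag e + 2 G diag c)` (`formPairing_mixedForm`). Times `∏ ℓ_r`, it is a bordered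
determinant `facetDet`, polynomial in `(c, e, x)`; for `c = 1`, `e = 0` it has no zeros on `P`,
because the normals at each point of `P` are independent and all normals together span
(`facetDet_one_zero_ne_zero`). So the half-forms contribute a continuous function on `P` times
`∏ ℓ_r^{-1/4}`. The modulus of the coefficient is `∏ ℓ_r^{ℓ_r(m)/2} e^{(ℓ_r(m) - ℓ_r)/2}`, and
`ℓ_r(m) ≥ 1/2` since the constants are half-integral, so the product `density` is continuous on the
compact set `P`. All integrals therefore converge, and define functionals bounded in the supremum
norm.

*The limit.* For `s > 0` the density is `s^{p/2}` times one that depends continuously on `1/s ≥ 0`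
(`density_rescale`). With `x_j = m_j + b_j / √s` for `j ≤ p`, the factor `s^{p/2}` is absorbed by
the substitution (`sectionFunctional_gcst`), and dominated convergence applies, first in the
remaining actions and the angles and then in `b`, where `e^{-|b|²/2}` has integral `√(2π)^p`. The slice
`x_j = m_j` meets the boundary of `P` in a null set because `m` is an interior point. -/

/-! ### Decomposable forms and their pairing -/

lemma wedgeOne_apply {n : ℕ} (η : Fin n → Phase n →L[ℝ] ℂ) (v : Fin n → Phase n) :
    wedgeOne η v = Matrix.det (Matrix.of fun i j => η j (v i)) := rfl

lemma norm_wedgeOne_le {n : ℕ} (η : Fin n → Phase n →L[ℝ] ℂ) :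
    ‖wedgeOne η‖ ≤ n.factorial * ∏ j, ‖η j‖ := by
  refine ContinuousAlternatingMap.opNorm_le_bound _ (by positivity) fun v => ?_
  rw [wedgeOne_apply, Matrix.det_apply]
  refine (norm_sum_le _ _).trans ?_
  have h : ∀ σ ∈ (Finset.univ : Finset (Equiv.Perm (Fin n))),
      ‖Equiv.Perm.sign σ • ∏ i, Matrix.of (fun i j => η j (v i)) (σ i) i‖ ≤
        (∏ j, ‖η j‖) * ∏ i, ‖v i‖ := by
    intro σ _
    have h1 : ‖Equiv.Perm.sign σ • ∏ i, Matrix.of (fun i j => η j (v i)) (σ i) i‖ =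
        ∏ i, ‖η i (v (σ i))‖ := by
      rw [← norm_prod]
      rcases Int.units_eq_one_or (Equiv.Perm.sign σ) with h | h <;> simp [h]
    rw [h1, ← Equiv.prod_comp σ (fun i => ‖v i‖), ← Finset.prod_mul_distrib]
    exact Finset.prod_le_prod (fun _ _ => norm_nonneg _) fun i _ => (η i).le_opNorm _
  refine (Finset.sum_le_sum h).trans (le_of_eq ?_)
  simp [Finset.card_univ, Fintype.card_perm, mul_assoc]

lemma wedgeOne_update_apply {n : ℕ} (η : Fin n → Phase n →L[ℝ] ℂ) (i : Fin n)
    (c : Phase n →L[ℝ] ℂ) (v : Fin n → Phase n) :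
    wedgeOne (Function.update η i c) v =
      ((Matrix.of fun k j => η j (v k)).updateCol i fun k => c (v k)).det := by
  rw [wedgeOne_apply]
  congr 1
  ext k j
  by_cases hj : j = i
  · subst hj; simp
  · simp [hj]

/-- The wedge product of one-forms, as a continuous multilinear map. -/
noncomputable def wedgeMultilinear (n : ℕ) :
    ContinuousMultilinearMap ℂ (fun _ : Fin n => Phase n →L[ℝ] ℂ) (NForm n) :=
  MultilinearMap.mkContinuous
    { toFun := wedgeOne
      map_update_add' := by
        intro inst η i a b
        obtain rfl : inst = instDecidableEqFin n := Subsingleton.elim _ _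
        ext v
        rw [ContinuousAlternatingMap.add_apply, wedgeOne_update_apply, wedgeOne_update_apply,
          wedgeOne_update_apply, ← Matrix.det_updateCol_add]
        rfl
      map_update_smul' := by
        intro inst η i c a
        obtain rfl : inst = instDecidableEqFin n := Subsingleton.elim _ _
        ext v
        rw [ContinuousAlternatingMap.smul_apply, wedgeOne_update_apply, wedgeOne_update_apply,
          smul_eq_mul, ← Matrix.det_updateCol_smul]
        rfl }
    n.factorial norm_wedgeOne_le

lemma continuous_wedgeOne {n : ℕ} :
    Continuous (wedgeOne : (Fin n → Phase n →L[ℝ] ℂ) → NForm n) :=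
  (wedgeMultilinear n).cont

lemma differentiable_wedgeOne_pencil {n : ℕ} (a b : Fin n → Phase n →L[ℝ] ℂ) :
    Differentiable ℂ fun c : ℂ => wedgeOne fun j => a j + c • b j := by
  have h := (wedgeMultilinear n).contDiff (n := 1)
  exact (h.differentiable one_ne_zero).comp (f := fun c : ℂ => fun j => a j + c • b j)
    (by fun_prop)

lemma wedgeOne_compContinuousLinearMap {n : ℕ} (η : Fin n → Phase n →L[ℝ] ℂ)
    (f : Phase n →L[ℝ] Phase n) :
    (wedgeOne η).compContinuousLinearMap f = wedgeOne fun j => (η j).comp f := rfl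

lemma wedgeOne_diagonal {n : ℕ} (a : Fin n → ℂ) (η : Fin n → Phase n →L[ℝ] ℂ) :
    wedgeOne (fun j => a j • η j) = (∏ j, a j) • wedgeOne η :=
  (wedgeMultilinear n).map_smul_univ a η

/-- On decomposable `n`-forms, `α ∧ β̄` is a determinant of size `2n`. -/
lemma wedgeConj_wedgeOne {n : ℕ} (η ζ : Fin n → Phase n →L[ℝ] ℂ) (v : Fin n ⊕ Fin n → Phase n) :
    wedgeConj (wedgeOne η) (wedgeOne ζ) v =
      Matrix.det (Matrix.of fun a : Fin n ⊕ Fin n =>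
        Sum.elim (fun j => η j (v a)) (fun j => (starRingEnd ℂ) (ζ j (v a)))) := by
  set N : Matrix (Fin n ⊕ Fin n) (Fin n ⊕ Fin n) ℂ := Matrix.of fun a : Fin n ⊕ Fin n =>
        Sum.elim (fun j => η j (v a)) (fun j => (starRingEnd ℂ) (ζ j (v a))) with hN
  -- each pair of permutations in the expansion of the two factors contributes one copy of `det N`
  have key : ∀ τ₁ τ₂ : Equiv.Perm (Fin n),
      ∑ σ : Equiv.Perm (Fin n ⊕ Fin n), ((Equiv.Perm.sign σ : ℤ) : ℂ) *
        ((((Equiv.Perm.sign τ₁ : ℤ) : ℂ) * ∏ i, N (σ (Sum.inl (τ₁ i))) (Sum.inl i)) *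
         (((Equiv.Perm.sign τ₂ : ℤ) : ℂ) * ∏ i, N (σ (Sum.inr (τ₂ i))) (Sum.inr i))) = N.det := by
    intro τ₁ τ₂
    rw [Matrix.det_apply']
    rw [← Equiv.sum_comp (Equiv.mulRight (Equiv.Perm.sumCongr τ₁ τ₂))
      (fun σ => ((Equiv.Perm.sign σ : ℤ) : ℂ) * ∏ i, N (σ i) i)]
    refine Finset.sum_congr rfl fun σ _ => ?_
    simp only [Equiv.coe_mulRight, Equiv.Perm.sign_mul, Equiv.Perm.sign_sumCongr,
      Fintype.prod_sum_type, Equiv.Perm.mul_apply, Equiv.Perm.sumCongr_apply, Sum.map_inl,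
      Sum.map_inr]
    push_cast
    ring
  have hα : ∀ σ : Equiv.Perm (Fin n ⊕ Fin n), wedgeOne η (fun i => v (σ (Sum.inl i))) =
      ∑ τ : Equiv.Perm (Fin n), ((Equiv.Perm.sign τ : ℤ) : ℂ) *
        ∏ i, N (σ (Sum.inl (τ i))) (Sum.inl i) := by
    intro σ
    rw [wedgeOne_apply, Matrix.det_apply']
    rfl
  have hβ : ∀ σ : Equiv.Perm (Fin n ⊕ Fin n),
      (starRingEnd ℂ) (wedgeOne ζ (fun i => v (σ (Sum.inr i)))) =
      ∑ τ : Equiv.Perm (Fin n), ((Equiv.Perm.sign τ : ℤ) : ℂ) *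
        ∏ i, N (σ (Sum.inr (τ i))) (Sum.inr i) := by
    intro σ
    rw [wedgeOne_apply, Matrix.det_apply', map_sum]
    refine Finset.sum_congr rfl fun τ _ => ?_
    rw [map_mul, map_prod]
    simp [hN]
  have hsum : ∑ σ : Equiv.Perm (Fin n ⊕ Fin n), ((Equiv.Perm.sign σ : ℤ) : ℂ) *
      (wedgeOne η (fun i => v (σ (Sum.inl i))) *
        (starRingEnd ℂ) (wedgeOne ζ (fun i => v (σ (Sum.inr i))))) =
      ∑ τ₁ : Equiv.Perm (Fin n), ∑ τ₂ : Equiv.Perm (Fin n), N.det := by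
    simp_rw [hα, hβ, Finset.sum_mul_sum, Finset.mul_sum (Finset.univ : Finset (Equiv.Perm (Fin n)))]
    rw [Finset.sum_comm]
    refine Finset.sum_congr rfl fun τ₁ _ => ?_
    rw [Finset.sum_comm]
    exact Finset.sum_congr rfl fun τ₂ _ => key τ₁ τ₂
  have hn : (n.factorial : ℂ) ≠ 0 := by exact_mod_cast n.factorial_ne_zero
  rw [wedgeConj, hsum]
  simp only [Finset.sum_const, Finset.card_univ, Fintype.card_perm, Fintype.card_fin, nsmul_eq_mul]
  field_simp

/-- The pairing of `⋀ⱼ (∑ₖ A k j dxₖ + i cⱼ dθⱼ)` with `⋀ⱼ (∑ₖ G k j dxₖ + i dθⱼ)`, for real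
coefficients. -/
lemma formPairing_wedgeOne {n : ℕ} (η ζ : Fin n → Phase n →L[ℝ] ℂ)
    (A G : Matrix (Fin n) (Fin n) ℝ) (c : Fin n → ℝ)
    (hη : ∀ j i, η j (ddx i) = (A i j : ℂ))
    (hη' : ∀ j i, η j (ddθ i) = if i = j then Complex.I * (c j : ℂ) else 0)
    (hζ : ∀ j i, ζ j (ddx i) = (G i j : ℂ))
    (hζ' : ∀ j i, ζ j (ddθ i) = if i = j then Complex.I else 0) :
    formPairing (wedgeOne η) (wedgeOne ζ) =
      (((A + G * Matrix.diagonal c).det / 2 ^ n : ℝ) : ℂ) := by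
  have hM : (Matrix.of fun a : Fin n ⊕ Fin n =>
        Sum.elim (fun j => η j (Sum.elim ddx ddθ a))
          (fun j => (starRingEnd ℂ) (ζ j (Sum.elim ddx ddθ a)))) =
      Matrix.fromBlocks (A.map Complex.ofReal) (G.map Complex.ofReal)
        (Complex.I • (Matrix.diagonal c).map Complex.ofReal)
        ((-Complex.I) • (1 : Matrix (Fin n) (Fin n) ℂ)) := by
    ext a b
    rcases a with a | a <;> rcases b with b | b
    · simp [hη]
    · simp [hζ]
    · by_cases h : a = b
      · subst h; simp [hη']
      · simp [hη', h]
    · by_cases h : a = b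
      · subst h; simp [hζ']
      · simp [hζ', h]
  have hI : ((-Complex.I) • (1 : Matrix (Fin n) (Fin n) ℂ)) *
      (Complex.I • (1 : Matrix (Fin n) (Fin n) ℂ)) = 1 := by
    simp [smul_smul]
  have hI' : (Complex.I • (1 : Matrix (Fin n) (Fin n) ℂ)) *
      ((-Complex.I) • (1 : Matrix (Fin n) (Fin n) ℂ)) = 1 := by
    simp [smul_smul]
  let _ : Invertible ((-Complex.I) • (1 : Matrix (Fin n) (Fin n) ℂ)) := ⟨_, hI', hI⟩
  have hinv : ⅟((-Complex.I) • (1 : Matrix (Fin n) (Fin n) ℂ)) =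
      Complex.I • (1 : Matrix (Fin n) (Fin n) ℂ) := rfl
  have hdet : (A.map Complex.ofReal + G.map Complex.ofReal *
      (Matrix.diagonal c).map Complex.ofReal).det =
      (((A + G * Matrix.diagonal c).det : ℝ) : ℂ) := by
    have := (Complex.ofRealHom.map_det (A + G * Matrix.diagonal c)).symm
    rw [map_add, map_mul] at this
    exact this
  have hpow : ((-1 : ℂ)) ^ (n * (n + 1) / 2) * (-1) ^ (n * (n - 1) / 2) = (-1) ^ n := by
    have h : n * (n + 1) / 2 + n * (n - 1) / 2 = n * n := by
      have h1 : 2 ∣ n * (n + 1) := (Nat.even_mul_succ_self n).two_dvd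
      have h2 : 2 ∣ n * (n - 1) := (Nat.even_mul_pred_self n).two_dvd
      rw [← Nat.add_div_of_dvd_right h1, ← Nat.mul_add]
      rcases n with _ | n
      · rfl
      · have : n + 1 + 1 + (n + 1 - 1) = 2 * (n + 1) := by omega
        rw [this]
        have : (n + 1) * (2 * (n + 1)) = 2 * ((n + 1) * (n + 1)) := by ring
        rw [this]; omega
    rw [← pow_add, h, pow_mul]
    rcases Nat.even_or_odd n with h | h
    · simp [h.neg_one_pow]
    · simp [h.neg_one_pow]
  unfold formPairing
  rw [wedgeConj_wedgeOne, hM, Matrix.det_fromBlocks₂₂, hinv]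
  have : A.map Complex.ofReal -
      G.map Complex.ofReal * (Complex.I • (1 : Matrix (Fin n) (Fin n) ℂ)) *
      (Complex.I • (Matrix.diagonal c).map Complex.ofReal) = A.map Complex.ofReal +
        G.map Complex.ofReal * (Matrix.diagonal c).map Complex.ofReal := by
    simp [smul_smul, sub_eq_add_neg]
  rw [this, hdet, mul_assoc, hpow]
  simp only [Matrix.det_smul, Matrix.det_one, Fintype.card_fin, mul_one]
  rw [← mul_pow]
  have h2 : (2 * Complex.I * -1) ^ n = 2 ^ n * (-Complex.I) ^ n := by rw [← mul_pow]; ring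
  have h3 : (-Complex.I) ^ n ≠ 0 := pow_ne_zero _ (neg_ne_zero.mpr Complex.I_ne_zero)
  rw [h2]
  push_cast
  field_simp

/-! ### Calculus on the polytope -/

/-- The complex valued one-form `dx_j` on phase space. -/
noncomputable def dxForm {n : ℕ} (j : Fin n) : Phase n →L[ℝ] ℂ :=
  Complex.ofRealCLM.comp ((ContinuousLinearMap.proj j).comp
    (ContinuousLinearMap.fst ℝ (Fin n → ℝ) (Fin n → ℝ)))

/-- The complex valued one-form `dθ_j` on phase space. -/
noncomputable def dθForm {n : ℕ} (j : Fin n) : Phase n →L[ℝ] ℂ :=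
  Complex.ofRealCLM.comp ((ContinuousLinearMap.proj j).comp
    (ContinuousLinearMap.snd ℝ (Fin n → ℝ) (Fin n → ℝ)))

lemma dxForm_apply {n : ℕ} (j : Fin n) (q : Phase n) : dxForm j q = (q.1 j : ℂ) := rfl

lemma dθForm_apply {n : ℕ} (j : Fin n) (q : Phase n) : dθForm j q = (q.2 j : ℂ) := rfl

lemma fderiv_fst_coord {n : ℕ} (j : Fin n) (q : Phase n) :
    fderiv ℝ (fun q' : Phase n => (q'.1 j : ℂ)) q = dxForm j :=
  (dxForm j).hasFDerivAt.fderiv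

namespace DelzantPolytope

variable {n d : ℕ} (P : DelzantPolytope n d)

/-- The linear part `x ↦ ⟨x, ν_r⟩` of `ℓ_r`. -/
noncomputable def normal (r : Fin d) : (Fin n → ℝ) →L[ℝ] ℝ :=
  ∑ j, (P.ν r j : ℝ) • ContinuousLinearMap.proj j

lemma normal_apply (r : Fin d) (x : Fin n → ℝ) : P.normal r x = ∑ j, x j * (P.ν r j : ℝ) := by
  simp [normal, mul_comm]

lemma ell_eq (r : Fin d) (x : Fin n → ℝ) :
    P.ell r x = P.normal r x + ((P.lamL r : ℝ) + 1 / 2) := by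
  rw [normal_apply, ell]

lemma normal_single (r : Fin d) (j : Fin n) : P.normal r (Pi.single j 1) = P.ν r j := by
  simp [normal_apply, Pi.single_apply]

lemma hasFDerivAt_ell (r : Fin d) (x : Fin n → ℝ) : HasFDerivAt (P.ell r) (P.normal r) x := by
  have : P.ell r = fun x => P.normal r x + ((P.lamL r : ℝ) + 1 / 2) := funext (P.ell_eq r)
  rw [this]
  exact (P.normal r).hasFDerivAt.add_const _

lemma continuous_ell (r : Fin d) : Continuous (P.ell r) := by
  unfold ell; fun_prop

lemma ell_sub (r : Fin d) (x x' : Fin n → ℝ) :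
    P.ell r x - P.ell r x' = ∑ j, (x j - x' j) * (P.ν r j : ℝ) := by
  simp only [ell, sub_mul, Finset.sum_sub_distrib]
  ring

lemma isOpen_inner : IsOpen P.inner := by
  have : P.inner = ⋂ r, {x | 0 < P.ell r x} := by ext; simp [inner]
  rw [this]
  exact isOpen_iInter_of_finite fun r => isOpen_lt continuous_const (P.continuous_ell r)

lemma inner_subset_carrier : P.inner ⊆ P.carrier := fun _ hx r => (hx r).le

lemma isCompact_carrier : IsCompact P.carrier := by
  refine Metric.isCompact_of_isClosed_isBounded ?_ P.bounded
  have : P.carrier = ⋂ r, {x | 0 ≤ P.ell r x} := by ext; simp [carrier]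
  rw [this]
  exact isClosed_iInter fun r => isClosed_le continuous_const (P.continuous_ell r)

lemma inner_nonempty : P.inner.Nonempty := P.full

lemma isOpen_openOrbit : IsOpen P.openOrbit := P.isOpen_inner.preimage continuous_fst

/-- A lattice point of `P` stays away from the facets, as the constants are half-integral. -/
lemma half_le_ell {m : Fin n → ℤ} (hm : (fun j => (m j : ℝ)) ∈ P.carrier) (r : Fin d) :
    1 / 2 ≤ P.ell r fun j => (m j : ℝ) := by
  have h := hm r
  have e : P.ell r (fun j => (m j : ℝ)) = ((∑ j, m j * P.ν r j + P.lamL r : ℤ) : ℝ) + 1 / 2 := by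
    simp only [ell]; push_cast; ring
  rw [e] at h ⊢
  have : (-1 : ℝ) < ((∑ j, m j * P.ν r j + P.lamL r : ℤ) : ℝ) := by linarith
  have : (-1 : ℤ) < ∑ j, m j * P.ν r j + P.lamL r := by exact_mod_cast this
  have : (0 : ℤ) ≤ ∑ j, m j * P.ν r j + P.lamL r := by omega
  have : (0 : ℝ) ≤ ((∑ j, m j * P.ν r j + P.lamL r : ℤ) : ℝ) := by exact_mod_cast this
  linarith

/-- The normals span, since `P` is bounded. -/
lemma eq_zero_of_normal_eq_zero {v : Fin n → ℝ} (hv : ∀ r, P.normal r v = 0) : v = 0 := by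
  obtain ⟨x, hx⟩ := P.inner_nonempty
  by_contra hne
  obtain ⟨C, hC⟩ := P.isCompact_carrier.isBounded.exists_norm_le
  have hmem : ∀ t : ℝ, x + t • v ∈ P.carrier := by
    intro t r
    have := (hx r).le
    rw [ell_eq] at this ⊢
    rw [map_add, map_smul, hv r]
    simpa using this
  have h1 := hC _ (hmem ((C + 1 + ‖x‖) / ‖v‖))
  have h0 : ‖x‖ ≤ C := hC _ (P.inner_subset_carrier hx)
  have hv0 : 0 < ‖v‖ := norm_pos_iff.mpr hne
  have h2 : ‖((C + 1 + ‖x‖) / ‖v‖) • v‖ = C + 1 + ‖x‖ := by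
    rw [norm_smul, Real.norm_of_nonneg (div_nonneg (by linarith [norm_nonneg x]) hv0.le)]
    field_simp
  have h3 := norm_sub_le (x + ((C + 1 + ‖x‖) / ‖v‖) • v) x
  rw [add_sub_cancel_left, h2] at h3
  linarith

/-- The normals of the facets through a point of `P` are linearly independent. -/
lemma eq_zero_of_sum_active {x : Fin n → ℝ} (hx : x ∈ P.carrier) (a : Fin d → ℝ)
    (ha : ∀ r, P.ell r x ≠ 0 → a r = 0) (hsum : ∀ j, ∑ r, a r * (P.ν r j : ℝ) = 0) : a = 0 := by
  obtain ⟨b, hb⟩ := P.delzant x hx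
  have hinj : ∀ r r', P.ν r = P.ν r' → P.ell r x = 0 → P.ell r' x = 0 → r = r' := by
    intro r r' h h0 h0'
    by_contra hne
    obtain ⟨w, hw, hw'⟩ := P.facet r
    have e : P.lamL r = P.lamL r' := by
      have : (P.lamL r : ℝ) = P.lamL r' := by
        simp only [ell, h] at h0 h0'; linarith
      exact_mod_cast this
    have := hw' r' (Ne.symm hne)
    rw [← h, ← e] at this
    linarith
  -- a coordinate function of the `ℤ`-basis, extended to real coefficients
  have hcoord : ∀ i : Fin n, ∑ r, a r * ((b.coord i (P.ν r) : ℤ) : ℝ) = 0 := by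
    intro i
    have h1 : ∀ r, b.coord i (P.ν r) = ∑ j, P.ν r j * b.coord i (Pi.single j 1) := by
      intro r
      conv_lhs => rw [pi_eq_sum_univ' (P.ν r)]
      rw [map_sum]
      refine Finset.sum_congr rfl fun j _ => ?_
      rw [map_smul, smul_eq_mul]
    simp_rw [h1]
    push_cast
    simp_rw [Finset.mul_sum]
    rw [Finset.sum_comm]
    refine Finset.sum_eq_zero fun j _ => ?_
    simp_rw [← mul_assoc]
    rw [← Finset.sum_mul, hsum j, zero_mul]
  funext r
  by_cases hr : P.ell r x = 0
  · obtain ⟨i, hi⟩ := hb r hr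
    have := hcoord i
    rw [Finset.sum_eq_single r] at this
    · simpa [← hi] using this
    · intro r' _ hne
      by_cases hr' : P.ell r' x = 0
      · obtain ⟨i', hi'⟩ := hb r' hr'
        have : i' ≠ i := by
          rintro rfl
          exact hne (hinj r' r (hi'.symm.trans hi) hr' hr)
        rw [← hi']
        simp [Module.Basis.coord_apply, this]
      · rw [ha r' hr', zero_mul]
    · simp
  · exact ha r hr

/-- The Hessian `G = ½ ∑ ν_r ν_rᵀ / ℓ_r` of the symplectic potential. -/
noncomputable def hess (x : Fin n → ℝ) : Matrix (Fin n) (Fin n) ℝ :=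
  Matrix.of fun j k => (1 / 2) * ∑ r, (P.ν r j : ℝ) * (P.ν r k : ℝ) / P.ell r x

lemma hess_transpose (x : Fin n → ℝ) : (P.hess x).transpose = P.hess x := by
  ext j k
  simp [hess, mul_comm]

lemma hess_posDef {x : Fin n → ℝ} (hx : x ∈ P.inner) : (P.hess x).PosDef := by
  refine Matrix.PosDef.of_dotProduct_mulVec_pos ?_ fun v hv => ?_
  · rw [Matrix.IsHermitian, Matrix.conjTranspose_eq_transpose_of_trivial, hess_transpose]
  have h : star v ⬝ᵥ (P.hess x).mulVec v = (1 / 2) * ∑ r, P.normal r v ^ 2 / P.ell r x := by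
    simp only [dotProduct, Matrix.mulVec, hess, Matrix.of_apply, star_trivial, normal_apply]
    simp only [Finset.mul_sum, Finset.sum_mul, pow_two, Finset.sum_div]
    symm
    rw [Finset.sum_comm]
    refine Finset.sum_congr rfl fun j _ => ?_
    rw [Finset.sum_comm]
    exact Finset.sum_congr rfl fun k _ => Finset.sum_congr rfl fun r _ => by ring
  rw [h]
  have hpos : ∀ r, 0 ≤ P.normal r v ^ 2 / P.ell r x := fun r => div_nonneg (sq_nonneg _) (hx r).le
  have : ∃ r, P.normal r v ≠ 0 := by
    by_contra! hc
    exact hv (P.eq_zero_of_normal_eq_zero hc)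
  obtain ⟨r, hr⟩ := this
  have : 0 < ∑ r, P.normal r v ^ 2 / P.ell r x :=
    Finset.sum_pos' (fun r _ => hpos r) ⟨r, Finset.mem_univ _, div_pos (by positivity) (hx r)⟩
  linarith

lemma hasFDerivAt_potential {x : Fin n → ℝ} (hx : x ∈ P.inner) :
    HasFDerivAt P.potential
      ((1 / 2 : ℝ) • ∑ r, (Real.log (P.ell r x) + 1) • P.normal r) x := by
  have h : ∀ r ∈ (Finset.univ : Finset (Fin d)),
      HasFDerivAt (fun x => P.ell r x * Real.log (P.ell r x))
        ((Real.log (P.ell r x) + 1) • P.normal r) x := fun r _ =>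
    (Real.hasDerivAt_mul_log (hx r).ne').comp_hasFDerivAt x (P.hasFDerivAt_ell r x)
  exact (HasFDerivAt.fun_sum h).const_mul (1 / 2)

lemma y_eq {x : Fin n → ℝ} (hx : x ∈ P.inner) (j : Fin n) :
    P.y j x = (1 / 2) * ∑ r, (Real.log (P.ell r x) + 1) * (P.ν r j : ℝ) := by
  rw [y, (P.hasFDerivAt_potential hx).fderiv]
  simp [normal_single]

lemma hasFDerivAt_y {x : Fin n → ℝ} (hx : x ∈ P.inner) (j : Fin n) :
    HasFDerivAt (P.y j)
      (∑ k, P.hess x j k • (ContinuousLinearMap.proj k : (Fin n → ℝ) →L[ℝ] ℝ)) x := by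
  have h : ∀ r ∈ (Finset.univ : Finset (Fin d)),
      HasFDerivAt (fun x => (Real.log (P.ell r x) + 1) * (P.ν r j : ℝ))
        ((P.ν r j : ℝ) • ((P.ell r x)⁻¹ • P.normal r)) x := fun r _ =>
    (((P.hasFDerivAt_ell r x).log (hx r).ne').add_const 1).mul_const _
  have h2 := (HasFDerivAt.fun_sum h).const_mul (1 / 2)
  have h3 : P.y j =ᶠ[nhds x]
      fun x => (1 / 2) * ∑ r, (Real.log (P.ell r x) + 1) * (P.ν r j : ℝ) := by
    filter_upwards [P.isOpen_inner.mem_nhds hx] with x' hx' using P.y_eq hx' j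
  refine (h2.congr_of_eventuallyEq h3).congr_fderiv ?_
  ext v
  simp only [hess, Matrix.of_apply, normal, smul_apply,
    sum_apply, ContinuousLinearMap.proj_apply, smul_eq_mul, Finset.mul_sum,
    Finset.sum_mul]
  rw [Finset.sum_comm]
  refine Finset.sum_congr rfl fun k _ => Finset.sum_congr rfl fun r _ => by ring

/-- The one-form `dz_j = ∑ₖ G_{jk} dx_k + i dθ_j` over the point `x` of the interior. -/
noncomputable def dzForm (j : Fin n) (x : Fin n → ℝ) : Phase n →L[ℝ] ℂ :=
  ∑ k, (P.hess x j k : ℂ) • dxForm k + Complex.I • dθForm j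

lemma fderiv_z {q : Phase n} (hq : q ∈ P.openOrbit) (j : Fin n) :
    fderiv ℝ (P.z j) q = P.dzForm j q.1 := by
  have h1 : HasFDerivAt (fun q : Phase n => (P.y j q.1 : ℂ))
      (Complex.ofRealCLM.comp ((∑ k, P.hess q.1 j k •
        (ContinuousLinearMap.proj k : (Fin n → ℝ) →L[ℝ] ℝ)).comp
        (ContinuousLinearMap.fst ℝ (Fin n → ℝ) (Fin n → ℝ)))) q :=
    Complex.ofRealCLM.hasFDerivAt.comp q ((P.hasFDerivAt_y hq j).comp q hasFDerivAt_fst)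
  have h2 : HasFDerivAt (fun q : Phase n => Complex.I * (q.2 j : ℂ)) (Complex.I • dθForm j) q :=
    (dθForm j).hasFDerivAt.const_mul Complex.I
  have h3 := (h1.add h2).fderiv
  refine Eq.trans h3 ?_
  refine ContinuousLinearMap.ext fun v => ?_
  simp [dzForm, dxForm, dθForm]

lemma dZ_eq {q : Phase n} (hq : q ∈ P.openOrbit) : P.dZ q = wedgeOne fun j => P.dzForm j q.1 := by
  simp only [dZ, P.fderiv_z hq]

lemma dXdZ_eq {q : Phase n} (hq : q ∈ P.openOrbit) (p : ℕ) :
    P.dXdZ p q = wedgeOne fun j => if j.val < p then dxForm j else P.dzForm j q.1 := by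
  simp only [dXdZ, P.fderiv_z hq, fderiv_fst_coord]

lemma continuousOn_hess (j k : Fin n) : ContinuousOn (fun x => P.hess x j k) P.inner := by
  simp only [hess, Matrix.of_apply]
  refine continuousOn_const.mul (continuousOn_finsetSum _ fun r _ => ?_)
  exact continuousOn_const.div (P.continuous_ell r).continuousOn fun x hx => (hx r).ne'

lemma continuousOn_dzForm (j : Fin n) : ContinuousOn (P.dzForm j) P.inner := by
  unfold dzForm
  refine ContinuousOn.add (continuousOn_finsetSum _ fun k _ => ?_) continuousOn_const
  exact (Complex.continuous_ofReal.comp_continuousOn (P.continuousOn_hess j k)).smul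
    continuousOn_const

/-- The exponent `m · y - k` of the norm of a monomial section, in terms of the `ℓ_r`. -/
lemma sum_mul_y_sub_kahler {x : Fin n → ℝ} (hx : x ∈ P.inner) (c : Fin n → ℝ) :
    ∑ j, c j * P.y j x - P.kahler x =
      (1 / 2) * ∑ r, (P.ell r c * Real.log (P.ell r x) + (P.ell r c - P.ell r x)) := by
  have h1 : ∑ j, c j * P.y j x - P.kahler x =
      ∑ j, (c j - x j) * P.y j x + P.potential x := by
    simp only [kahler, sub_mul, Finset.sum_sub_distrib]; ring
  have h2 : ∑ j, (c j - x j) * P.y j x =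
      (1 / 2) * ∑ r, (Real.log (P.ell r x) + 1) * (P.ell r c - P.ell r x) := by
    simp_rw [P.y_eq hx, ell_sub, Finset.mul_sum]
    rw [Finset.sum_comm]
    refine Finset.sum_congr rfl fun r _ => Finset.sum_congr rfl fun j _ => by ring
  rw [h1, h2, potential, ← mul_add, ← Finset.sum_add_distrib]
  congr 1
  exact Finset.sum_congr rfl fun r _ => by ring

end DelzantPolytope

/-! ### The operators on Fourier modes -/

/-- The function `f(x) e^{i m·θ}` on phase space. -/
noncomputable def fourierMode {n : ℕ} (m : Fin n → ℤ) (f : (Fin n → ℝ) → ℂ) (q : Phase n) : ℂ :=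
  f q.1 * Complex.exp (Complex.I * ∑ j, (m j : ℂ) * (q.2 j : ℂ))

lemma fderiv_fourierMode {n : ℕ} (m : Fin n → ℤ) {f : (Fin n → ℝ) → ℂ} {q : Phase n}
    (hf : DifferentiableAt ℝ f q.1) (v : Fin n → ℝ) :
    fderiv ℝ (fourierMode m f) q (0, v) =
      Complex.I * (∑ j, (m j : ℂ) * (v j : ℂ)) * fourierMode m f q := by
  have h1 : HasFDerivAt (fun q : Phase n => f q.1)
      ((fderiv ℝ f q.1).comp (ContinuousLinearMap.fst ℝ (Fin n → ℝ) (Fin n → ℝ))) q :=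
    hf.hasFDerivAt.comp q hasFDerivAt_fst
  have h2 : HasFDerivAt (fun q : Phase n => Complex.I * ∑ j, (m j : ℂ) * (q.2 j : ℂ))
      (Complex.I • ∑ j, (m j : ℂ) • dθForm j) q :=
    (HasFDerivAt.fun_sum fun j _ => (dθForm j).hasFDerivAt.const_mul (m j : ℂ)).const_mul _
  have h3 := (h1.mul h2.cexp).fderiv
  change fderiv ℝ ((fun q : Phase n => f q.1) *
    fun q => Complex.exp (Complex.I * ∑ j, (m j : ℂ) * (q.2 j : ℂ))) q (0, v) = _
  rw [h3]
  simp [fourierMode, dθForm]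
  ring

lemma prequantumOp_congr {n : ℕ} (F : Phase n → ℝ) {ψ φ : Phase n → ℂ} {q : Phase n}
    (h : ψ =ᶠ[nhds q] φ) : prequantumOp F ψ q = prequantumOp F φ q := by
  simp only [prequantumOp, covDeriv, h.fderiv_eq, h.eq_of_nhds]

lemma hamVF_coord {n : ℕ} (j : Fin n) (q : Phase n) :
    hamVF (fun q' => q'.1 j) q = (0, -Pi.single j 1) := by
  have h : fderiv ℝ (fun q' : Phase n => q'.1 j) q = (ContinuousLinearMap.proj j).comp
      (ContinuousLinearMap.fst ℝ (Fin n → ℝ) (Fin n → ℝ)) :=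
    ((ContinuousLinearMap.proj j).comp
      (ContinuousLinearMap.fst ℝ (Fin n → ℝ) (Fin n → ℝ))).hasFDerivAt.fderiv
  simp only [hamVF, h]
  ext k
  · simp [ddθ]
  · simp [ddx, Pi.single_apply, eq_comm]

/-- The linear vector field `-∑_{j ≤ p} xⱼ ∂/∂θⱼ`, which is the Hamiltonian vector field of
`½ ∑_{j ≤ p} xⱼ²`. -/
noncomputable def shear {n : ℕ} (p : ℕ) : Phase n →L[ℝ] Phase n :=
  ContinuousLinearMap.prod 0 (ContinuousLinearMap.pi fun j =>
    if j.val < p then -(ContinuousLinearMap.proj j).comp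
      (ContinuousLinearMap.fst ℝ (Fin n → ℝ) (Fin n → ℝ)) else 0)

lemma shear_apply {n : ℕ} (p : ℕ) (q : Phase n) :
    shear p q = (0, fun j => if j.val < p then -q.1 j else 0) := by
  ext j
  · simp [shear]
  · by_cases h : j.val < p <;> simp [shear, h]

lemma hamVF_hamiltonian {n : ℕ} (p : ℕ) :
    hamVF (fun q : Phase n => hamiltonian p q.1) = shear p := by
  funext q
  have h0 : ∀ j ∈ (Finset.univ : Finset (Fin n)),
      HasFDerivAt (fun q : Phase n => if j.val < p then q.1 j ^ 2 else 0)
        (if j.val < p then (2 * q.1 j) • (ContinuousLinearMap.proj j).comp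
          (ContinuousLinearMap.fst ℝ (Fin n → ℝ) (Fin n → ℝ)) else 0) q := by
    intro j _
    have hp : HasFDerivAt (fun q : Phase n => q.1 j) ((ContinuousLinearMap.proj j).comp
          (ContinuousLinearMap.fst ℝ (Fin n → ℝ) (Fin n → ℝ))) q :=
      ((ContinuousLinearMap.proj j).comp
        (ContinuousLinearMap.fst ℝ (Fin n → ℝ) (Fin n → ℝ))).hasFDerivAt
    by_cases h : j.val < p
    · simpa [h] using hp.pow 2
    · simpa [h] using hasFDerivAt_const (0 : ℝ) q
  have h := ((HasFDerivAt.fun_sum h0).const_mul (1 / 2)).fderiv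
  have h' : fderiv ℝ (fun q : Phase n => hamiltonian p q.1) q = _ := h
  rw [shear_apply]
  simp only [hamVF, h']
  ext k
  · simp only [ddθ, Pi.zero_apply, smul_apply, sum_apply]
    rw [Finset.sum_eq_zero, smul_zero]
    intro j _
    split_ifs <;> simp
  · simp only [ddx, smul_apply, sum_apply]
    rw [Finset.sum_eq_single k]
    · by_cases hk : k.val < p <;> simp [hk]
    · intro j _ hj
      split_ifs <;> simp [hj]
    · simp

lemma prequantumOp_coord_fourierMode {n : ℕ} (m : Fin n → ℤ) {f : (Fin n → ℝ) → ℂ} {q : Phase n}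
    (hf : DifferentiableAt ℝ f q.1) (j : Fin n) :
    prequantumOp (fun q' => q'.1 j) (fourierMode m f) q = m j * fourierMode m f q := by
  simp only [prequantumOp, covDeriv, hamVF_coord, fderiv_fourierMode m hf]
  have h1 : ∑ k, (m k : ℂ) * (((-Pi.single j 1 : Fin n → ℝ) k : ℝ) : ℂ) = -(m j : ℂ) := by
    rw [Finset.sum_eq_single j]
    · simp
    · intro k _ hk; simp [hk]
    · simp
  have h2 : ∑ k, q.1 k * (-Pi.single j 1 : Fin n → ℝ) k = -q.1 j := by
    rw [Finset.sum_eq_single j]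
    · simp
    · intro k _ hk; simp [hk]
    · simp
  rw [h1, h2]
  push_cast
  linear_combination (-(m j : ℂ) * fourierMode m f q + q.1 j * fourierMode m f q) *
    Complex.I_mul_I

lemma prequantumOp_hamiltonian_fourierMode {n : ℕ} (p : ℕ) (m : Fin n → ℤ)
    {f : (Fin n → ℝ) → ℂ} {q : Phase n} (hf : DifferentiableAt ℝ f q.1) :
    prequantumOp (fun q' => hamiltonian p q'.1) (fourierMode m f) q =
      ((-hamiltonian p q.1 + ∑ j : Fin n, if j.val < p then q.1 j * m j else 0 : ℝ) : ℂ) *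
        fourierMode m f q := by
  simp only [prequantumOp, covDeriv, hamVF_hamiltonian, shear_apply, fderiv_fourierMode m hf]
  have h1 : ∑ j : Fin n, (m j : ℂ) * ((if j.val < p then -q.1 j else 0 : ℝ) : ℂ) =
      -((∑ j : Fin n, if j.val < p then q.1 j * m j else 0 : ℝ) : ℂ) := by
    push_cast
    rw [← Finset.sum_neg_distrib]
    refine Finset.sum_congr rfl fun j _ => ?_
    split_ifs <;> simp [mul_comm]
  have h2 : ∑ j : Fin n, q.1 j * (if j.val < p then -q.1 j else 0) = -2 * hamiltonian p q.1 := by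
    rw [hamiltonian, ← mul_assoc, Finset.mul_sum]
    refine Finset.sum_congr rfl fun j _ => ?_
    split_ifs <;> ring
  rw [h1, h2]
  generalize (∑ j : Fin n, if j.val < p then q.1 j * (m j : ℝ) else 0) = T
  push_cast
  linear_combination (-(T : ℂ) *
    fourierMode m f q + 2 * hamiltonian p q.1 * fourierMode m f q) * Complex.I_mul_I

/-- The exponential series of an operator which multiplies the Fourier mode `m` over the open set
`S` by a function of the actions. -/
lemma hasSum_expTerm_fourierMode {n : ℕ} {S : Set (Fin n → ℝ)} {m : Fin n → ℤ}
    {A : (Phase n → ℂ) → Phase n → ℂ} {l : (Fin n → ℝ) → ℂ} (hl : DifferentiableOn ℝ l S)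
    (hA : ∀ (ψ : Phase n → ℂ) (f : (Fin n → ℝ) → ℂ), DifferentiableOn ℝ f S →
      Set.EqOn ψ (fourierMode m f) {q | q.1 ∈ S} →
      Set.EqOn (A ψ) (fourierMode m fun x => l x * f x) {q | q.1 ∈ S})
    {ψ : Phase n → ℂ} {f : (Fin n → ℝ) → ℂ} (hf : DifferentiableOn ℝ f S)
    (hψ : Set.EqOn ψ (fourierMode m f) {q | q.1 ∈ S}) (c : ℂ) {q : Phase n} (hq : q.1 ∈ S) :
    HasSum (expTerm A c ψ q) (fourierMode m (fun x => Complex.exp (c * l x) * f x) q) := by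
  have hit : ∀ k : ℕ, DifferentiableOn ℝ (fun x => l x ^ k * f x) S ∧
      Set.EqOn (A^[k] ψ) (fourierMode m fun x => l x ^ k * f x) {q | q.1 ∈ S} := by
    intro k
    induction k with
    | zero => simpa using ⟨hf, hψ⟩
    | succ k ih =>
      refine ⟨(hl.pow (k + 1)).mul hf, ?_⟩
      rw [Function.iterate_succ_apply']
      refine (hA _ _ ih.1 ih.2).trans fun q _ => ?_
      simp only [fourierMode]
      ring
  have h := (NormedSpace.expSeries_div_hasSum_exp (𝔸 := ℂ) (c * l q.1)).mul_right
    (fourierMode m f q)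
  rw [← Complex.exp_eq_exp_ℂ] at h
  have h1 : expTerm A c ψ q = fun k : ℕ => (c * l q.1) ^ k / (k.factorial : ℂ) *
      fourierMode m f q := by
    funext k
    rw [expTerm, (hit k).2 hq]
    simp only [fourierMode, smul_eq_mul, mul_pow]
    ring
  have h2 : fourierMode m (fun x => Complex.exp (c * l x) * f x) q =
      Complex.exp (c * l q.1) * fourierMode m f q := by
    simp only [fourierMode]
    ring
  rw [h1, h2]
  exact h

namespace DelzantPolytope

variable {n d : ℕ} (P : DelzantPolytope n d)

/-- The modulus `e^{m·y - k}` of the monomial section, as a function of the actions. -/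
noncomputable def amplitude (m : Fin n → ℤ) (x : Fin n → ℝ) : ℝ :=
  Real.exp (∑ j, (m j : ℝ) * P.y j x - P.kahler x)

lemma monomialSection_coeff (m : Fin n → ℤ) :
    (P.monomialSection m).coeff = fourierMode m fun x => (P.amplitude m x : ℂ) := by
  funext q
  simp only [monomialSection, w, z, fourierMode, amplitude, ← Complex.exp_int_mul,
    ← Complex.exp_sum, ← Complex.exp_add, Complex.ofReal_exp]
  congr 1
  push_cast
  simp only [mul_add, Finset.sum_add_distrib, Finset.mul_sum]
  have : ∑ j, (m j : ℂ) * (Complex.I * (q.2 j : ℂ)) = ∑ j, Complex.I * ((m j : ℂ) * (q.2 j : ℂ)) :=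
    Finset.sum_congr rfl fun j _ => by ring
  rw [this]
  ring

lemma limitDensity_coeff (p : ℕ) (m : Fin n → ℤ) :
    (P.limitDensity p m).coeff = (P.monomialSection m).coeff := by
  funext q
  have h : ∀ j : Fin n, (if j.val < p then (1 : ℂ) else Complex.exp ((m j : ℂ) * P.z j q)) =
      Complex.exp (if j.val < p then 0 else (m j : ℂ) * P.z j q) := by
    intro j; split_ifs <;> simp
  simp only [limitDensity, monomialSection, w, ← Complex.exp_int_mul, h, ← Complex.exp_sum,
    ← Complex.exp_add]
  congr 1
  rw [add_comm (∑ j, _), add_assoc, add_assoc]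
  congr 1
  rw [Finset.mul_sum, ← Finset.sum_add_distrib, ← Finset.sum_add_distrib]
  refine Finset.sum_congr rfl fun j _ => ?_
  split_ifs
  · simp only [z]; ring
  · simp

lemma differentiableOn_amplitude (m : Fin n → ℤ) :
    DifferentiableOn ℝ (fun x => (P.amplitude m x : ℂ)) P.inner := by
  intro x hx
  have hy : ∀ j, DifferentiableAt ℝ (P.y j) x := fun j => (P.hasFDerivAt_y hx j).differentiableAt
  have hg : DifferentiableAt ℝ P.potential x := (P.hasFDerivAt_potential hx).differentiableAt
  have : DifferentiableAt ℝ (P.amplitude m) x := by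
    unfold amplitude kahler
    fun_prop
  exact (Complex.ofRealCLM.differentiableAt.comp x this).differentiableWithinAt

lemma eventuallyEq_of_eqOn_openOrbit {ψ φ : Phase n → ℂ} (h : Set.EqOn ψ φ P.openOrbit)
    {q : Phase n} (hq : q ∈ P.openOrbit) : ψ =ᶠ[nhds q] φ := by
  filter_upwards [P.isOpen_openOrbit.mem_nhds hq] with q' hq' using h hq'

lemma quantumOp_eqOn (p : ℕ) (m : Fin n → ℤ) (ψ : Phase n → ℂ) (f : (Fin n → ℝ) → ℂ)
    (hf : DifferentiableOn ℝ f P.inner) (hψ : Set.EqOn ψ (fourierMode m f) P.openOrbit) :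
    Set.EqOn (quantumOp p ψ) (fourierMode m fun x =>
      (hamiltonian p (fun j => (m j : ℝ)) : ℂ) * f x) P.openOrbit := by
  intro q hq
  have h1 : ∀ j : Fin n, ∀ q ∈ P.openOrbit, prequantumOp (fun q' => q'.1 j) ψ q =
      fourierMode m (fun x => m j * f x) q := by
    intro j q hq
    rw [prequantumOp_congr _ (P.eventuallyEq_of_eqOn_openOrbit hψ hq),
      prequantumOp_coord_fourierMode m ((hf _ hq).differentiableAt (P.isOpen_inner.mem_nhds hq))]
    simp only [fourierMode, mul_assoc]
  have h2 : ∀ j : Fin n, prequantumOp (fun q' => q'.1 j) (prequantumOp (fun q' => q'.1 j) ψ) q =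
      (m j : ℂ) ^ 2 * fourierMode m f q := by
    intro j
    rw [prequantumOp_congr _ (P.eventuallyEq_of_eqOn_openOrbit (h1 j) hq),
      prequantumOp_coord_fourierMode m (((hf.const_mul _) _ hq).differentiableAt
        (P.isOpen_inner.mem_nhds hq))]
    simp only [fourierMode]
    ring
  simp only [quantumOp, h2, hamiltonian]
  push_cast
  simp only [fourierMode]
  rw [mul_assoc, mul_assoc, Finset.sum_mul]
  congr 1
  refine Finset.sum_congr rfl fun j _ => ?_
  split_ifs <;> simp

lemma prequantumOp_hamiltonian_eqOn (p : ℕ) (m : Fin n → ℤ) (ψ : Phase n → ℂ)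
    (f : (Fin n → ℝ) → ℂ) (hf : DifferentiableOn ℝ f P.inner)
    (hψ : Set.EqOn ψ (fourierMode m f) P.openOrbit) :
    Set.EqOn (prequantumOp (fun q' => hamiltonian p q'.1) ψ) (fourierMode m fun x =>
      ((-hamiltonian p x + ∑ j : Fin n, if j.val < p then x j * m j else 0 : ℝ) : ℂ) * f x)
      P.openOrbit := by
  intro q hq
  rw [prequantumOp_congr _ (P.eventuallyEq_of_eqOn_openOrbit hψ hq),
    prequantumOp_hamiltonian_fourierMode p m
      ((hf _ hq).differentiableAt (P.isOpen_inner.mem_nhds hq))]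
  simp only [fourierMode, mul_assoc]

lemma differentiable_symbol (p : ℕ) (m : Fin n → ℤ) : Differentiable ℝ fun x : Fin n → ℝ =>
    ((-hamiltonian p x + ∑ j : Fin n, if j.val < p then x j * m j else 0 : ℝ) : ℂ) := by
  have h : Differentiable ℝ fun x : Fin n → ℝ =>
      (-hamiltonian p x + ∑ j : Fin n, if j.val < p then x j * m j else 0 : ℝ) := by
    unfold hamiltonian
    refine ((Differentiable.fun_sum fun j _ => ?_).const_mul _).neg.add
      (Differentiable.fun_sum fun j _ => ?_)
    · split_ifs <;> fun_prop
    · split_ifs <;> fun_prop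
  exact Complex.ofRealCLM.differentiable.comp h

lemma hasSum_quantumOp (p : ℕ) (m : Fin n → ℤ) (c : ℂ) {q : Phase n} (hq : q ∈ P.openOrbit) :
    HasSum (expTerm (quantumOp p) c (P.monomialSection m).coeff q)
      (fourierMode m (fun x => Complex.exp (c * (hamiltonian p (fun j => (m j : ℝ)) : ℂ)) *
        P.amplitude m x) q) :=
  hasSum_expTerm_fourierMode (S := P.inner) (A := quantumOp p)
    (l := fun _ => (hamiltonian p (fun j => (m j : ℝ)) : ℂ))
    (differentiableOn_const _) (P.quantumOp_eqOn p m) (P.differentiableOn_amplitude m)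
    (fun q _ => by rw [monomialSection_coeff]) c hq

lemma hasSum_prequantumOp (p : ℕ) (m : Fin n → ℤ) (s : ℝ) {q : Phase n} (hq : q ∈ P.openOrbit) :
    HasSum (expTerm (prequantumOp fun q' => hamiltonian p q'.1) (s : ℂ)
      (expOp (quantumOp p) (-(s : ℂ)) (P.monomialSection m).coeff) q)
      (((Real.exp (-s * hamiltonian p fun j => q.1 j - m j) : ℝ) : ℂ) *
        fourierMode m (fun x => (P.amplitude m x : ℂ)) q) := by
  have h := hasSum_expTerm_fourierMode (S := P.inner)
    (A := prequantumOp fun q' => hamiltonian p q'.1)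
    (differentiable_symbol p m).differentiableOn (P.prequantumOp_hamiltonian_eqOn p m)
    ((P.differentiableOn_amplitude m).const_mul
      (Complex.exp (-(s : ℂ) * (hamiltonian p (fun j => (m j : ℝ)) : ℂ))))
    (fun q hq => (P.hasSum_quantumOp p m (-(s : ℂ)) hq).tsum_eq) (s : ℂ) hq
  have h1 : hamiltonian p (fun j => q.1 j - m j) = hamiltonian p q.1 +
      hamiltonian p (fun j => (m j : ℝ)) -
      ∑ j : Fin n, if j.val < p then q.1 j * m j else 0 := by
    simp only [hamiltonian]
    rw [← mul_add, ← Finset.sum_add_distrib, Finset.mul_sum, Finset.mul_sum,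
      ← Finset.sum_sub_distrib]
    refine Finset.sum_congr rfl fun j _ => ?_
    split_ifs <;> ring
  have h2 : ((Real.exp (-s * hamiltonian p fun j => q.1 j - m j) : ℝ) : ℂ) =
      Complex.exp (s * ((-hamiltonian p q.1 +
        ∑ j : Fin n, if j.val < p then q.1 j * m j else 0 : ℝ) : ℂ)) *
      Complex.exp (-(s : ℂ) * (hamiltonian p (fun j => (m j : ℝ)) : ℂ)) := by
    rw [← Complex.exp_add, Complex.ofReal_exp, h1]
    congr 1
    push_cast
    ring
  rw [h2]
  simp only [fourierMode] at h ⊢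
  rw [mul_assoc, ← mul_assoc (Complex.exp (-(s : ℂ) * _)), ← mul_assoc]
  exact h

lemma gcst_coeff (p : ℕ) (m : Fin n → ℤ) (s : ℝ) {q : Phase n} (hq : q ∈ P.openOrbit) :
    (gcst p s (P.monomialSection m)).coeff q =
      ((Real.exp (-s * hamiltonian p fun j => q.1 j - m j) : ℝ) : ℂ) *
        fourierMode m (fun x => (P.amplitude m x : ℂ)) q :=
  (P.hasSum_prequantumOp p m s hq).tsum_eq

end DelzantPolytope

/-! ### The Lie derivative and its exponential -/

/-- Pullback of `n`-forms along a linear map of phase space, as a complex linear map. -/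
noncomputable def pullbackForm {n : ℕ} (f : Phase n →L[ℝ] Phase n) : NForm n →L[ℂ] NForm n where
  toFun α := α.compContinuousLinearMap f
  map_add' _ _ := rfl
  map_smul' _ _ := rfl
  cont := (ContinuousAlternatingMap.compContinuousLinearMapCLM f).cont

lemma pullbackForm_apply {n : ℕ} (f : Phase n →L[ℝ] Phase n) (α : NForm n) :
    pullbackForm f α = α.compContinuousLinearMap f := rfl

/-- `zero_smul` for one-forms, whose complex module structure `rw` does not find by itself. -/
lemma oneForm_zero_smul {n : ℕ} (η : Phase n →L[ℝ] ℂ) : (0 : ℂ) • η = 0 := zero_smul ℂ η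

lemma oneForm_smul_zero {n : ℕ} (c : ℂ) : c • (0 : Phase n →L[ℝ] ℂ) = 0 :=
  ContinuousLinearMap.ext fun _ => mul_zero c

lemma nForm_smul_ofReal_smul {n : ℕ} (r : ℝ) (c : ℂ) (α : NForm n) :
    r • c • α = ((r : ℂ) * c) • α :=
  ContinuousAlternatingMap.ext fun v => by
    change r • (c * α v) = r * c * α v
    rw [Complex.real_smul, mul_assoc]

lemma iteratedDeriv_clm_comp {E F : Type*} [NormedAddCommGroup E] [NormedSpace ℂ E]
    [NormedAddCommGroup F] [NormedSpace ℂ F] (T : E →L[ℂ] F) {g : ℂ → E} (hg : ContDiff ℂ ∞ g)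
    (k : ℕ) : iteratedDeriv k (fun c => T (g c)) = fun c => T (iteratedDeriv k g c) := by
  induction k with
  | zero => simp
  | succ k ih =>
    rw [iteratedDeriv_succ, ih]
    funext c
    rw [iteratedDeriv_succ]
    have h : DifferentiableAt ℂ (iteratedDeriv k g) c :=
      (hg.differentiable_iteratedDeriv k (by exact_mod_cast ENat.natCast_lt_top k)) c
    exact (T.hasFDerivAt.comp_hasDerivAt c h.hasDerivAt).deriv

namespace DelzantPolytope

variable {n d : ℕ} (P : DelzantPolytope n d)

/-- The `n`-form `⋀_{j ≤ p} (dz_j - i c dx_j) ∧ ⋀_{j > p} dz_j`, which for real `c` is the pullback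
of `dZ` under the Hamiltonian flow of `½ ∑_{j ≤ p} xⱼ²` at time `c`. -/
noncomputable def flowForm (p : ℕ) (x : Fin n → ℝ) (c : ℂ) : NForm n :=
  wedgeOne fun j => P.dzForm j x + c • (if j.val < p then (-Complex.I) • dxForm j else 0)

lemma differentiable_flowForm (p : ℕ) (x : Fin n → ℝ) : Differentiable ℂ (P.flowForm p x) :=
  differentiable_wedgeOne_pencil _ _

lemma pullback_flowForm (p : ℕ) (x : Fin n → ℝ) (c : ℂ) (t : ℝ) :
    pullbackForm (ContinuousLinearMap.id ℝ (Phase n) + t • shear p) (P.flowForm p x c) =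
      P.flowForm p x (c + t) := by
  rw [pullbackForm_apply, flowForm, wedgeOne_compContinuousLinearMap, flowForm]
  congr 1
  funext j
  refine ContinuousLinearMap.ext fun v => ?_
  have h : ∀ j, ((v + t • shear p v).1 j : ℝ) = v.1 j := by
    intro j; simp [shear_apply]
  have h' : ∀ j, ((v + t • shear p v).2 j : ℝ) = v.2 j + t * (if j.val < p then -v.1 j else 0) := by
    intro j; simp [shear_apply]
  have hdx : ∀ k : Fin n, dxForm k (v + t • shear p v) = dxForm k v := by
    intro k; rw [dxForm_apply, h, dxForm_apply]
  have hdθ : dθForm j (v + t • shear p v) =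
      dθForm j v + t * (if j.val < p then -dxForm j v else 0) := by
    rw [dθForm_apply, h', dθForm_apply, dxForm_apply]
    split_ifs <;> simp
  change (P.dzForm j x + c • (if j.val < p then (-Complex.I) • dxForm j else 0))
    (v + t • shear p v) = _
  simp only [dzForm, add_apply, smul_apply, sum_apply, hdx, hdθ]
  split_ifs
  · simp only [smul_apply, hdx, smul_eq_mul]; ring
  · simp

/-- Pulling back by the flow translates the time of `flowForm`, so that Lie derivatives are
derivatives in time. -/
lemma iterate_lieDeriv_dZ (p k : ℕ) {q : Phase n} (hq : q ∈ P.openOrbit) :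
    (lieDeriv (hamVF fun q' => hamiltonian p q'.1))^[k] P.dZ q =
      iteratedDeriv k (P.flowForm p q.1) 0 := by
  induction k generalizing q with
  | zero =>
    simp only [Function.iterate_zero, id, iteratedDeriv_zero, P.dZ_eq hq, flowForm,
      oneForm_zero_smul, add_zero]
  | succ k ih =>
    rw [Function.iterate_succ_apply', hamVF_hamiltonian, lieDeriv]
    have hC : ContDiff ℂ ∞ (P.flowForm p q.1) := (P.differentiable_flowForm p q.1).contDiff
    have h : (fun t : ℝ =>
        ((lieDeriv (shear p))^[k] P.dZ (q + t • shear p q)).compContinuousLinearMap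
          (ContinuousLinearMap.id ℝ (Phase n) + t • fderiv ℝ (shear p) q)) =
        fun t : ℝ => iteratedDeriv k (P.flowForm p q.1) (t : ℂ) := by
      funext t
      have hfst : (q + t • shear p q).1 = q.1 := by simp [shear_apply]
      have ih' := @ih (q + t • shear p q) (by change (q + t • shear p q).1 ∈ P.inner; rwa [hfst])
      rw [hamVF_hamiltonian, hfst] at ih'
      rw [ih', ContinuousLinearMap.fderiv, ← pullbackForm_apply]
      have h1 := congrFun (iteratedDeriv_clm_comp
        (pullbackForm (ContinuousLinearMap.id ℝ (Phase n) + t • shear p)) hC k) 0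
      rw [← h1]
      simp only [pullback_flowForm]
      have h2 := congrFun (iteratedDeriv_comp_add_const k (P.flowForm p q.1) (t : ℂ)) 0
      simpa using h2
    rw [h, iteratedDeriv_succ]
    have hd : HasDerivAt (iteratedDeriv k (P.flowForm p q.1))
        (deriv (iteratedDeriv k (P.flowForm p q.1)) 0) ((0 : ℝ) : ℂ) := by
      rw [Complex.ofReal_zero]
      exact ((hC.differentiable_iteratedDeriv k
        (by exact_mod_cast ENat.natCast_lt_top k)) 0).hasDerivAt
    have := HasDerivAt.scomp (0 : ℝ) hd Complex.ofRealCLM.hasDerivAt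
    simpa [Function.comp_def] using this.deriv

/-- The Hamiltonian flow in imaginary time: the exponential series is the Taylor series of
`flowForm` at `0`, evaluated at `i s`. -/
lemma hasSum_lieDeriv (p : ℕ) (s : ℝ) {q : Phase n} (hq : q ∈ P.openOrbit) :
    HasSum (expTerm (lieDeriv (hamVF fun q' => hamiltonian p q'.1)) (Complex.I * (s : ℂ)) P.dZ q)
      (wedgeOne fun j => if j.val < p then P.dzForm j q.1 + (s : ℂ) • dxForm j
        else P.dzForm j q.1) := by
  have h := Complex.hasSum_taylorSeries_of_entire (P.differentiable_flowForm p q.1) 0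
    (Complex.I * (s : ℂ))
  have h1 : expTerm (lieDeriv (hamVF fun q' => hamiltonian p q'.1)) (Complex.I * (s : ℂ)) P.dZ q =
      fun k : ℕ => (k.factorial : ℂ)⁻¹ • (Complex.I * (s : ℂ) - 0) ^ k •
        iteratedDeriv k (P.flowForm p q.1) 0 := by
    funext k
    rw [expTerm, P.iterate_lieDeriv_dZ p k hq, smul_smul, sub_zero, div_eq_inv_mul]
  have h2 : P.flowForm p q.1 (Complex.I * (s : ℂ)) =
      wedgeOne fun j => if j.val < p then P.dzForm j q.1 + (s : ℂ) • dxForm j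
        else P.dzForm j q.1 := by
    rw [flowForm]
    congr 1
    funext j
    split_ifs
    · rw [smul_smul]
      congr 2
      linear_combination -(s : ℂ) * Complex.I_mul_I
    · rw [oneForm_smul_zero, add_zero]
  rw [h1, ← h2]
  exact h

lemma gcst_form (p : ℕ) (m : Fin n → ℤ) (s : ℝ) {q : Phase n} (hq : q ∈ P.openOrbit) :
    (gcst p s (P.monomialSection m)).form q =
      wedgeOne fun j => if j.val < p then P.dzForm j q.1 + (s : ℂ) • dxForm j
        else P.dzForm j q.1 :=
  (P.hasSum_lieDeriv p s hq).tsum_eq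

lemma prod_ite_lt_eq_pow {p : ℕ} (hp : p ≤ n) {R : Type*} [CommMonoid R] (a : R) :
    ∏ j : Fin n, (if j.val < p then a else 1) = a ^ p := by
  rw [Fin.prod_univ_eq_prod_range (fun j => if j < p then a else 1) n, ← Finset.prod_filter]
  have : (Finset.range n).filter (fun j => j < p) = Finset.range p := by
    ext j; simp; omega
  rw [this, Finset.prod_const, Finset.card_range]

lemma gcst_form_rescaled {p : ℕ} (hp : p ≤ n) (m : Fin n → ℤ) {s : ℝ} (hs : s ≠ 0) {q : Phase n}
    (hq : q ∈ P.openOrbit) :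
    (s ^ p)⁻¹ • (gcst p s (P.monomialSection m)).form q =
      wedgeOne fun j => if j.val < p then dxForm j + ((s⁻¹ : ℝ) : ℂ) • P.dzForm j q.1
        else P.dzForm j q.1 := by
  have hs' : (s : ℂ) ≠ 0 := by exact_mod_cast hs
  have h : (fun j : Fin n => if j.val < p then P.dzForm j q.1 + (s : ℂ) • dxForm j
      else P.dzForm j q.1) = fun j => (if j.val < p then (s : ℂ) else 1) •
        (if j.val < p then dxForm j + ((s⁻¹ : ℝ) : ℂ) • P.dzForm j q.1 else P.dzForm j q.1) := by
    funext j
    split_ifs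
    · rw [smul_add, smul_smul, Complex.ofReal_inv, mul_inv_cancel₀ hs', one_smul, add_comm]
    · rw [one_smul]
  rw [P.gcst_form p m s hq, h, wedgeOne_diagonal, prod_ite_lt_eq_pow hp]
  rw [nForm_smul_ofReal_smul, Complex.ofReal_inv, Complex.ofReal_pow,
    inv_mul_cancel₀ (pow_ne_zero _ hs')]
  exact one_smul ℂ _

lemma tendstoLocallyUniformlyOn_gcst_form {p : ℕ} (hp : p ≤ n) (m : Fin n → ℤ) :
    TendstoLocallyUniformlyOn
      (fun (s : ℝ) q => (s ^ p)⁻¹ • (gcst p s (P.monomialSection m)).form q)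
      (P.dXdZ p) Filter.atTop P.openOrbit := by
  -- with `t = 1/s`, the rescaled form is a function `Φ(t, q)` which is continuous at `t = 0`
  rw [P.isOpen_openOrbit.tendstoLocallyUniformlyOn_iff_forall_tendsto]
  intro q₀ hq₀
  set Φ : ℝ × Phase n → NForm n := fun a => wedgeOne fun j =>
    if j.val < p then dxForm j + (a.1 : ℂ) • P.dzForm j a.2.1 else P.dzForm j a.2.1 with hΦ
  have hdz : ∀ j, ContinuousAt (fun a : ℝ × Phase n => P.dzForm j a.2.1) (0, q₀) := fun j =>
    ContinuousAt.comp (f := fun a : ℝ × Phase n => a.2.1) (x := ((0 : ℝ), q₀))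
      ((P.continuousOn_dzForm j).continuousAt (P.isOpen_inner.mem_nhds hq₀)) (by fun_prop)
  have hcont : ContinuousAt Φ (0, q₀) := by
    refine continuous_wedgeOne.continuousAt.comp (continuousAt_pi.2 fun j => ?_)
    split_ifs
    · have hc : ContinuousAt (fun a : ℝ × Phase n => (a.1 : ℂ)) (0, q₀) := by fun_prop
      exact continuousAt_const.add (hc.smul (hdz j))
    · exact hdz j
  have h0 : ∀ q ∈ P.openOrbit, P.dXdZ p q = Φ (0, q) := by
    intro q hq
    simp only [hΦ, P.dXdZ_eq hq, Complex.ofReal_zero, oneForm_zero_smul, add_zero]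
  have hs : ∀ s : ℝ, s ≠ 0 → ∀ q ∈ P.openOrbit,
      (s ^ p)⁻¹ • (gcst p s (P.monomialSection m)).form q = Φ (s⁻¹, q) :=
    fun s hs q hq => P.gcst_form_rescaled hp m hs hq
  have hlim : Filter.Tendsto (fun a : ℝ × Phase n => (Φ (0, a.2), Φ (a.1⁻¹, a.2)))
      (Filter.atTop ×ˢ nhds q₀) (nhds (Φ (0, q₀), Φ (0, q₀))) := by
    refine Filter.Tendsto.prodMk_nhds (hcont.tendsto.comp ?_) (hcont.tendsto.comp ?_)
    · exact tendsto_const_nhds.prodMk_nhds Filter.tendsto_snd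
    · exact (tendsto_inv_atTop_zero.comp Filter.tendsto_fst).prodMk_nhds Filter.tendsto_snd
  refine (hlim.mono_right (nhds_le_uniformity _)).congr' ?_
  filter_upwards [(Filter.eventually_ne_atTop (0 : ℝ)).prod_mk
    (P.isOpen_openOrbit.mem_nhds hq₀)] with a ha
  rw [h0 _ ha.2, hs _ ha.1 _ ha.2]

end DelzantPolytope

/-! ### Half-form pairings up to the boundary -/

lemma Matrix.PosDef.det_diagonal_add_mul_diagonal_nonneg {n : ℕ} {A : Matrix (Fin n) (Fin n) ℝ}
    (hA : A.PosDef) {c e : Fin n → ℝ} (hc : ∀ j, 0 ≤ c j) (he : ∀ j, 0 ≤ e j) :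
    0 ≤ (Matrix.diagonal e + A * Matrix.diagonal c).det := by
  have hpos : ∀ c : Fin n → ℝ, (∀ j, 0 < c j) →
      0 ≤ (Matrix.diagonal e + A * Matrix.diagonal c).det := by
    intro c hc
    have h1 : Matrix.diagonal e + A * Matrix.diagonal c =
        (Matrix.diagonal (fun j => e j / c j) + A) * Matrix.diagonal c := by
      rw [add_mul, Matrix.diagonal_mul_diagonal]
      congr 2
      funext j
      rw [div_mul_cancel₀ _ (hc j).ne']
    have h2 : (Matrix.diagonal (fun j => e j / c j) + A).PosDef :=
      Matrix.PosDef.posSemidef_add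
        (Matrix.PosSemidef.diagonal fun j => div_nonneg (he j) (hc j).le) hA
    rw [h1, Matrix.det_mul, Matrix.det_diagonal]
    exact mul_nonneg h2.det_pos.le (Finset.prod_nonneg fun j _ => (hc j).le)
  -- the case of vanishing `c j` follows by continuity
  have hlim : Filter.Tendsto
      (fun t : ℝ => (Matrix.diagonal e + A * Matrix.diagonal fun j => c j + t).det)
      (nhdsWithin 0 (Set.Ioi 0)) (nhds (Matrix.diagonal e + A * Matrix.diagonal c).det) := by
    have hcont : Continuous
        fun t : ℝ => (Matrix.diagonal e + A * Matrix.diagonal fun j => c j + t).det := by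
      fun_prop
    have := hcont.tendsto 0
    simp only [add_zero] at this
    exact this.mono_left nhdsWithin_le_nhds
  refine ge_of_tendsto hlim ?_
  filter_upwards [self_mem_nhdsWithin] with t ht
  exact hpos _ fun j => add_pos_of_nonneg_of_pos (hc j) ht

lemma dxForm_ddx {n : ℕ} (j i : Fin n) : dxForm j (ddx i) = if i = j then 1 else 0 := by
  by_cases h : i = j
  · subst h; simp [dxForm_apply, ddx]
  · simp [dxForm_apply, ddx, h, Ne.symm h]

lemma dxForm_ddθ {n : ℕ} (j i : Fin n) : dxForm j (ddθ i) = 0 := by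
  simp [dxForm_apply, ddθ]

lemma dθForm_ddx {n : ℕ} (j i : Fin n) : dθForm j (ddx i) = 0 := by
  simp [dθForm_apply, ddx]

lemma dθForm_ddθ {n : ℕ} (j i : Fin n) : dθForm j (ddθ i) = if i = j then 1 else 0 := by
  by_cases h : i = j
  · subst h; simp [dθForm_apply, ddθ]
  · simp [dθForm_apply, ddθ, h, Ne.symm h]

lemma halfFormPairing_eq_sqrt {n : ℕ} {α β : NForm n} {a : ℝ} (ha : 0 ≤ a)
    (h : formPairing α β = (a : ℂ)) : halfFormPairing α β = (Real.sqrt a : ℂ) := by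
  rw [halfFormPairing, h, Real.sqrt_eq_rpow, Complex.ofReal_cpow ha]
  norm_num

namespace DelzantPolytope

variable {n d : ℕ} (P : DelzantPolytope n d)

/-- The `n`-form `⋀ⱼ (cⱼ dz_j + eⱼ dx_j)`. -/
noncomputable def mixedForm (c e : Fin n → ℝ) (x : Fin n → ℝ) : NForm n :=
  wedgeOne fun j => (c j : ℂ) • P.dzForm j x + (e j : ℂ) • dxForm j

/-- The matrix of normals, with rows indexed by the facets. -/
def normalMatrix : Matrix (Fin d) (Fin n) ℝ := Matrix.of fun r j => (P.ν r j : ℝ)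

/-- The bordered determinant `det [[diag ℓ, ν diag c], [-νᵀ, diag e]]`.  It is polynomial in
`(c, e, x)`, and equals `∏ ℓ_r · det (diag e + 2 G diag c)` over the interior of `P`. -/
noncomputable def facetDet (c e : Fin n → ℝ) (x : Fin n → ℝ) : ℝ :=
  (Matrix.fromBlocks (Matrix.diagonal fun r => P.ell r x) (P.normalMatrix * Matrix.diagonal c)
    (-P.normalMatrix.transpose) (Matrix.diagonal e)).det

lemma continuous_facetDet : Continuous fun a : (Fin n → ℝ) × (Fin n → ℝ) × (Fin n → ℝ) =>
    P.facetDet a.1 a.2.1 a.2.2 := by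
  unfold facetDet
  have h : ∀ r, Continuous fun a : (Fin n → ℝ) × (Fin n → ℝ) × (Fin n → ℝ) => P.ell r a.2.2 :=
    fun r => (P.continuous_ell r).comp (by fun_prop)
  refine Continuous.matrix_det (Continuous.matrix_fromBlocks ?_ ?_ continuous_const ?_)
  · exact Continuous.matrix_diagonal (continuous_pi h)
  · exact continuous_const.matrix_mul (by fun_prop)
  · fun_prop

lemma facetDet_eq {x : Fin n → ℝ} (hx : x ∈ P.inner) (c e : Fin n → ℝ) :
    P.facetDet c e x = (∏ r, P.ell r x) *
      (Matrix.diagonal e + (2 : ℝ) • P.hess x * Matrix.diagonal c).det := by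
  have h1 : (Matrix.diagonal fun r => P.ell r x) *
      (Matrix.diagonal fun r => (P.ell r x)⁻¹) = 1 := by
    rw [Matrix.diagonal_mul_diagonal, ← Matrix.diagonal_one]
    congr 1; funext r; exact mul_inv_cancel₀ (hx r).ne'
  have h2 : (Matrix.diagonal fun r => (P.ell r x)⁻¹) *
      (Matrix.diagonal fun r => P.ell r x) = 1 := by
    rw [Matrix.diagonal_mul_diagonal, ← Matrix.diagonal_one]
    congr 1; funext r; exact inv_mul_cancel₀ (hx r).ne'
  let _ : Invertible (Matrix.diagonal fun r => P.ell r x) := ⟨_, h2, h1⟩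
  have hinv : ⅟(Matrix.diagonal fun r => P.ell r x) = Matrix.diagonal fun r => (P.ell r x)⁻¹ := rfl
  have hG : P.normalMatrix.transpose * (Matrix.diagonal fun r => (P.ell r x)⁻¹) * P.normalMatrix =
      (2 : ℝ) • P.hess x := by
    ext j k
    rw [Matrix.mul_apply]
    simp only [Matrix.mul_diagonal, Matrix.transpose_apply, normalMatrix, Matrix.of_apply, hess,
      Matrix.smul_apply, smul_eq_mul, ← mul_assoc]
    norm_num
    exact Finset.sum_congr rfl fun r _ => by rw [div_eq_mul_inv]; ring
  rw [facetDet, Matrix.det_fromBlocks₁₁, Matrix.det_diagonal, hinv, ← hG]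
  congr 2
  rw [Matrix.neg_mul, Matrix.neg_mul, sub_neg_eq_add, ← Matrix.mul_assoc]

lemma prod_ell_pos {x : Fin n → ℝ} (hx : x ∈ P.inner) : 0 < ∏ r, P.ell r x :=
  Finset.prod_pos fun r _ => hx r

lemma facetDet_nonneg {x : Fin n → ℝ} (hx : x ∈ P.inner) {c e : Fin n → ℝ}
    (hc : ∀ j, 0 ≤ c j) (he : ∀ j, 0 ≤ e j) : 0 ≤ P.facetDet c e x := by
  rw [P.facetDet_eq hx]
  exact mul_nonneg (P.prod_ell_pos hx).le
    (((P.hess_posDef hx).smul two_pos).det_diagonal_add_mul_diagonal_nonneg hc he)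

/-- The Delzant condition makes `∏ ℓ_r · det G` extend to `P` without zeros. -/
lemma facetDet_one_zero_ne_zero {x : Fin n → ℝ} (hx : x ∈ P.carrier) :
    P.facetDet (fun _ => 1) (fun _ => 0) x ≠ 0 := by
  intro h0
  obtain ⟨v, hv, hker⟩ := Matrix.exists_mulVec_eq_zero_iff.mpr h0
  set a : Fin d → ℝ := fun r => v (Sum.inl r) with ha
  set b : Fin n → ℝ := fun j => v (Sum.inr j) with hb
  have h1 : ∀ r, P.ell r x * a r + P.normal r b = 0 := by
    intro r
    have := congrFun hker (Sum.inl r)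
    simpa [Matrix.mulVec, dotProduct, Matrix.diagonal_apply, normalMatrix, normal_apply,
      mul_comm, ha, hb] using this
  have h2 : ∀ j, ∑ r, a r * (P.ν r j : ℝ) = 0 := by
    intro j
    have := congrFun hker (Sum.inr j)
    simpa [Matrix.mulVec, dotProduct, Matrix.diagonal_apply, normalMatrix, mul_comm, ha] using this
  have h3 : ∑ r, a r * P.normal r b = 0 := by
    simp only [normal_apply, Finset.mul_sum]
    rw [Finset.sum_comm]
    refine Finset.sum_eq_zero fun j _ => ?_
    have : ∑ r, a r * (b j * (P.ν r j : ℝ)) = b j * ∑ r, a r * (P.ν r j : ℝ) := by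
      rw [Finset.mul_sum]; exact Finset.sum_congr rfl fun r _ => by ring
    rw [this, h2, mul_zero]
  have h4 : ∑ r, P.ell r x * a r ^ 2 = 0 := by
    have : ∀ r, P.ell r x * a r ^ 2 = -(a r * P.normal r b) := by
      intro r; linear_combination a r * h1 r
    simp only [this, Finset.sum_neg_distrib, h3, neg_zero]
  have h5 : ∀ r, P.ell r x ≠ 0 → a r = 0 := by
    intro r hr
    have := (Finset.sum_eq_zero_iff_of_nonneg fun r _ => mul_nonneg (hx r) (sq_nonneg (a r))).1 h4
      r (Finset.mem_univ r)
    simpa [hr] using this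
  have ha0 : a = 0 := P.eq_zero_of_sum_active hx a h5 h2
  have hb0 : b = 0 := P.eq_zero_of_normal_eq_zero fun r => by simpa [ha0] using h1 r
  apply hv
  funext i
  rcases i with r | j
  · exact congrFun ha0 r
  · exact congrFun hb0 j

lemma formPairing_mixedForm {x : Fin n → ℝ} (hx : x ∈ P.inner) (c e : Fin n → ℝ) :
    formPairing (P.mixedForm c e x) (wedgeOne fun j => P.dzForm j x) =
      ((P.facetDet c e x / 2 ^ n / ∏ r, P.ell r x : ℝ) : ℂ) := by
  have hdz : ∀ j i, P.dzForm j x (ddx i) = (P.hess x i j : ℂ) := by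
    intro j i
    rw [← P.hess_transpose, Matrix.transpose_apply]
    simp [dzForm, sum_apply, dxForm_ddx, dθForm_ddx]
  have hdz' : ∀ j i, P.dzForm j x (ddθ i) = if i = j then Complex.I else 0 := by
    intro j i
    simp [dzForm, sum_apply, dxForm_ddθ, dθForm_ddθ]
  have h := formPairing_wedgeOne
    (fun j => (c j : ℂ) • P.dzForm j x + (e j : ℂ) • dxForm j) (fun j => P.dzForm j x)
    (P.hess x * Matrix.diagonal c + Matrix.diagonal e) (P.hess x) c ?_ ?_ hdz hdz'
  · rw [mixedForm, h, P.facetDet_eq hx]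
    congr 1
    have h2 : P.hess x * Matrix.diagonal c + Matrix.diagonal e + P.hess x * Matrix.diagonal c =
        Matrix.diagonal e + (2 : ℝ) • P.hess x * Matrix.diagonal c := by
      rw [two_smul, add_mul]; abel
    rw [h2]
    have := (P.prod_ell_pos hx).ne'
    field_simp
  · intro j i
    simp only [add_apply, smul_apply, hdz, dxForm_ddx, Matrix.add_apply, Matrix.mul_diagonal,
      Matrix.diagonal_apply, smul_eq_mul]
    by_cases hij : i = j
    · subst hij; simp [mul_comm]
    · simp [hij, mul_comm]
  · intro j i
    simp only [add_apply, smul_apply, hdz', dxForm_ddθ, smul_eq_mul]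
    by_cases hij : i = j
    · simp [hij, mul_comm]
    · simp [hij]

/-- The modulus of the pairing of `w^m e^{-k} 𝟏 ⊗ √(⋀ⱼ (cⱼ dz_j + eⱼ dx_j))` with the unitary frame
of `L`.  The factors `∏ ℓ_r^{±1/2}` of the half-forms are absorbed by `ℓ_r^{ℓ_r(m)/2}`, and what
remains is continuous up to the boundary of `P`, as `ℓ_r(m) ≥ 1/2`. -/
noncomputable def density (m : Fin n → ℤ) (c e : Fin n → ℝ) (x : Fin n → ℝ) : ℝ :=
  Real.sqrt (P.facetDet c e x / 2 ^ n) /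
    Real.sqrt (Real.sqrt |P.facetDet (fun _ => 1) (fun _ => 0) x / 2 ^ n|) *
    ∏ r, (P.ell r x ^ (P.ell r (fun j => (m j : ℝ)) / 2 - 1 / 4) *
      Real.exp ((P.ell r (fun j => (m j : ℝ)) - P.ell r x) / 2))

lemma continuousOn_density {m : Fin n → ℤ} (hm : (fun j => (m j : ℝ)) ∈ P.carrier) :
    ContinuousOn (fun a : (Fin n → ℝ) × (Fin n → ℝ) × (Fin n → ℝ) => P.density m a.1 a.2.1 a.2.2)
      {a | a.2.2 ∈ P.carrier} := by
  unfold density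
  have h0 : Continuous fun a : (Fin n → ℝ) × (Fin n → ℝ) × (Fin n → ℝ) =>
      P.facetDet (fun _ => 1) (fun _ => 0) a.2.2 :=
    P.continuous_facetDet.comp
      (f := fun a : (Fin n → ℝ) × (Fin n → ℝ) × (Fin n → ℝ) => ((fun _ => 1), (fun _ => 0), a.2.2))
      (by fun_prop)
  refine ContinuousOn.mul (ContinuousOn.div ?_ ?_ fun a ha => ?_) ?_
  · exact (P.continuous_facetDet.div_const _).sqrt.continuousOn
  · exact (h0.div_const _).abs.sqrt.sqrt.continuousOn
  · have : 0 < |P.facetDet (fun _ => 1) (fun _ => 0) a.2.2 / 2 ^ n| :=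
      abs_pos.2 (div_ne_zero (P.facetDet_one_zero_ne_zero ha) (by positivity))
    exact (Real.sqrt_pos.2 (Real.sqrt_pos.2 this)).ne'
  · refine (continuous_finsetProd _ fun r _ => ?_).continuousOn
    have hl : Continuous fun a : (Fin n → ℝ) × (Fin n → ℝ) × (Fin n → ℝ) => P.ell r a.2.2 :=
      (P.continuous_ell r).comp (by fun_prop)
    refine (hl.rpow_const fun a => Or.inr ?_).mul (by fun_prop)
    linarith [P.half_le_ell hm r]

lemma amplitude_eq {x : Fin n → ℝ} (hx : x ∈ P.inner) (m : Fin n → ℤ) :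
    P.amplitude m x = Real.sqrt (Real.sqrt (∏ r, P.ell r x)) *
      ∏ r, (P.ell r x ^ (P.ell r (fun j => (m j : ℝ)) / 2 - 1 / 4) *
        Real.exp ((P.ell r (fun j => (m j : ℝ)) - P.ell r x) / 2)) := by
  have h : Real.sqrt (Real.sqrt (∏ r, P.ell r x)) = ∏ r, P.ell r x ^ (1 / 4 : ℝ) := by
    rw [Real.finsetProd_rpow _ _ fun r _ => (hx r).le, Real.sqrt_eq_rpow, Real.sqrt_eq_rpow,
      ← Real.rpow_mul (P.prod_ell_pos hx).le]
    norm_num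
  rw [h, ← Finset.prod_mul_distrib, amplitude, P.sum_mul_y_sub_kahler hx, Finset.mul_sum,
    Real.exp_sum]
  refine Finset.prod_congr rfl fun r _ => ?_
  rw [← mul_assoc, ← Real.rpow_add (hx r), Real.rpow_def_of_pos (hx r), ← Real.exp_add]
  congr 1
  ring

lemma pointPairing_eq {m : Fin n → ℤ} {σ : HalfFormSection n} {q : Phase n} (hq : q ∈ P.openOrbit)
    {a : ℝ} (hcoeff : σ.coeff q = (a : ℂ) * fourierMode m (fun x => (P.amplitude m x : ℂ)) q)
    {c e : Fin n → ℝ} (hc : ∀ j, 0 ≤ c j) (he : ∀ j, 0 ≤ e j)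
    (hform : σ.form q = P.mixedForm c e q.1) (τ : Phase n → ℂ) :
    P.pointPairing σ τ q = ((a * P.density m c e q.1 : ℝ) : ℂ) *
      (Complex.exp (Complex.I * ∑ j, (m j : ℂ) * (q.2 j : ℂ)) * (starRingEnd ℂ) (τ q)) := by
  have hx : q.1 ∈ P.inner := hq
  have hL := P.prod_ell_pos hx
  have h1 : halfFormPairing (σ.form q) (P.dZ q) =
      (Real.sqrt (P.facetDet c e q.1 / 2 ^ n / ∏ r, P.ell r q.1) : ℂ) := by
    rw [hform, P.dZ_eq hq]
    have := P.facetDet_nonneg hx hc he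
    exact halfFormPairing_eq_sqrt (by positivity) (P.formPairing_mixedForm hx c e)
  have h0 : 0 ≤ P.facetDet (fun _ => 1) (fun _ => 0) q.1 :=
    P.facetDet_nonneg hx (fun _ => zero_le_one) (fun _ => le_rfl)
  have hdZ : P.dZ q = P.mixedForm (fun _ => 1) (fun _ => 0) q.1 := by
    rw [P.dZ_eq hq, mixedForm]
    congr 1
    funext j
    rw [Complex.ofReal_zero, oneForm_zero_smul, add_zero, Complex.ofReal_one]
    exact (one_smul ℂ _).symm
  have h2 : halfFormPairing (P.dZ q) (P.dZ q) =
      (Real.sqrt (P.facetDet (fun _ => 1) (fun _ => 0) q.1 / 2 ^ n / ∏ r, P.ell r q.1) : ℂ) := by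
    nth_rewrite 1 [hdZ]
    rw [P.dZ_eq hq]
    exact halfFormPairing_eq_sqrt (by positivity) (P.formPairing_mixedForm hx _ _)
  have hS : 0 < Real.sqrt (Real.sqrt (∏ r, P.ell r q.1)) :=
    Real.sqrt_pos.2 (Real.sqrt_pos.2 hL)
  have key : P.amplitude m q.1 *
      (Real.sqrt (P.facetDet c e q.1 / 2 ^ n / ∏ r, P.ell r q.1) /
        Real.sqrt (Real.sqrt (P.facetDet (fun _ => 1) (fun _ => 0) q.1 / 2 ^ n /
          ∏ r, P.ell r q.1))) = P.density m c e q.1 := by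
    rw [P.amplitude_eq hx, density, abs_of_nonneg (by positivity), Real.sqrt_div' _ hL.le,
      Real.sqrt_div' _ hL.le, Real.sqrt_div' _ (Real.sqrt_nonneg _)]
    have hSS : Real.sqrt (∏ r, P.ell r q.1) =
        Real.sqrt (Real.sqrt (∏ r, P.ell r q.1)) * Real.sqrt (Real.sqrt (∏ r, P.ell r q.1)) :=
      (Real.mul_self_sqrt (Real.sqrt_nonneg _)).symm
    generalize Real.sqrt (Real.sqrt (∏ r, P.ell r q.1)) = S at *
    generalize ∏ r, (P.ell r q.1 ^ (P.ell r (fun j => (m j : ℝ)) / 2 - 1 / 4) *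
      Real.exp ((P.ell r (fun j => (m j : ℝ)) - P.ell r q.1) / 2)) = B
    rw [hSS]
    field_simp
  rw [pointPairing, hcoeff, h1, h2, Complex.norm_real, Real.norm_of_nonneg (Real.sqrt_nonneg _),
    ← key, fourierMode]
  push_cast
  ring

/-- The coefficient vector equal to `t` in the first `p` places and to `1` in the others. -/
def headCoeff (n p : ℕ) (t : ℝ) : Fin n → ℝ := fun j => if j.val < p then t else 1

/-- The coefficient vector equal to `t` in the first `p` places and to `0` in the others. -/
def headCoeff₀ (n p : ℕ) (t : ℝ) : Fin n → ℝ := fun j => if j.val < p then t else 0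

lemma headCoeff_nonneg {p : ℕ} {t : ℝ} (ht : 0 ≤ t) (j : Fin n) : 0 ≤ headCoeff n p t j := by
  unfold headCoeff; split_ifs <;> simp [ht]

lemma headCoeff₀_nonneg {p : ℕ} {t : ℝ} (ht : 0 ≤ t) (j : Fin n) : 0 ≤ headCoeff₀ n p t j := by
  unfold headCoeff₀; split_ifs <;> simp [ht]

lemma continuous_headCoeff (p : ℕ) : Continuous (headCoeff n p) := by
  refine continuous_pi fun j => ?_
  unfold headCoeff
  split_ifs
  · exact continuous_id
  · exact continuous_const

lemma density_rescale {p : ℕ} (hp : p ≤ n) (m : Fin n → ℤ) {s : ℝ} (hs : 0 < s) {x : Fin n → ℝ}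
    (hx : x ∈ P.inner) :
    P.density m (fun _ => 1) (headCoeff₀ n p s) x =
      Real.sqrt s ^ p * P.density m (headCoeff n p s⁻¹) (headCoeff₀ n p 1) x := by
  have h : P.facetDet (fun _ => 1) (headCoeff₀ n p s) x =
      s ^ p * P.facetDet (headCoeff n p s⁻¹) (headCoeff₀ n p 1) x := by
    have hM : Matrix.diagonal (headCoeff₀ n p s) +
        (2 : ℝ) • P.hess x * Matrix.diagonal (fun _ => 1) =
        (Matrix.diagonal (headCoeff₀ n p 1) +
          (2 : ℝ) • P.hess x * Matrix.diagonal (headCoeff n p s⁻¹)) *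
        Matrix.diagonal (headCoeff n p s) := by
      rw [add_mul, mul_assoc, Matrix.diagonal_mul_diagonal, Matrix.diagonal_mul_diagonal]
      congr 3 <;> funext j <;> simp only [headCoeff, headCoeff₀] <;>
        split_ifs <;> simp [hs.ne']
    rw [P.facetDet_eq hx, P.facetDet_eq hx, hM, Matrix.det_mul, Matrix.det_diagonal]
    have : ∏ j, headCoeff n p s j = s ^ p := prod_ite_lt_eq_pow hp s
    rw [this]
    ring
  have h2 : Real.sqrt (s ^ p) = Real.sqrt s ^ p := by
    rw [Real.sqrt_eq_iff_mul_self_eq (by positivity) (by positivity), ← mul_pow,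
      Real.mul_self_sqrt hs.le]
  rw [density, density, h, mul_div_assoc, Real.sqrt_mul (by positivity), h2]
  ring

lemma gcst_form_eq_mixedForm (p : ℕ) (m : Fin n → ℤ) (s : ℝ) {q : Phase n}
    (hq : q ∈ P.openOrbit) : (gcst p s (P.monomialSection m)).form q =
      P.mixedForm (fun _ => 1) (headCoeff₀ n p s) q.1 := by
  rw [P.gcst_form p m s hq, mixedForm]
  congr 1
  funext j
  have h1 : ((1 : ℝ) : ℂ) • P.dzForm j q.1 = P.dzForm j q.1 := by
    rw [Complex.ofReal_one]; exact one_smul ℂ _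
  rw [h1, headCoeff₀]
  split_ifs
  · rfl
  · rw [Complex.ofReal_zero, oneForm_zero_smul, add_zero]

lemma dXdZ_eq_mixedForm (p : ℕ) {q : Phase n} (hq : q ∈ P.openOrbit) :
    P.dXdZ p q = P.mixedForm (headCoeff n p 0) (headCoeff₀ n p 1) q.1 := by
  rw [P.dXdZ_eq hq, mixedForm]
  congr 1
  funext j
  rw [headCoeff, headCoeff₀]
  split_ifs
  · rw [Complex.ofReal_zero, oneForm_zero_smul, zero_add, Complex.ofReal_one]
    exact (one_smul ℂ _).symm
  · rw [Complex.ofReal_zero, oneForm_zero_smul, add_zero, Complex.ofReal_one]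
    exact (one_smul ℂ _).symm

end DelzantPolytope

/-! ### Test sections and bounded functionals -/

namespace DelzantPolytope

variable {n d : ℕ} (P : DelzantPolytope n d)

/-- The torus `Tᵈ` covers `Tⁿ`: a linear choice of `φ` with `∑ φ_r ν_r = θ`. -/
lemma exists_continuous_lift : ∃ φ : (Fin n → ℝ) → Fin d → ℝ, Continuous φ ∧
    ∀ θ, (fun j => ∑ r, φ θ r * (P.ν r j : ℝ)) = θ := by
  -- `φ_r = ½ ⟨ν_r, G⁻¹θ⟩ / ℓ_r` at any interior point, since `G = ½ ∑ ν_r ν_rᵀ / ℓ_r`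
  obtain ⟨x, hx⟩ := P.inner_nonempty
  have hdet : IsUnit (P.hess x).det := (P.hess_posDef hx).det_pos.ne'.isUnit
  refine ⟨fun θ r => 1 / 2 * P.normal r ((P.hess x)⁻¹.mulVec θ) / P.ell r x, ?_, fun θ => ?_⟩
  · refine continuous_pi fun r => ?_
    have : Continuous fun θ : Fin n → ℝ => (P.hess x)⁻¹.mulVec θ :=
      Continuous.matrix_mulVec continuous_const continuous_id
    exact (continuous_const.mul ((P.normal r).continuous.comp this)).div_const _
  · have h : (P.hess x).mulVec ((P.hess x)⁻¹.mulVec θ) = θ := by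
      rw [Matrix.mulVec_mulVec, Matrix.mul_nonsing_inv _ hdet, Matrix.one_mulVec]
    have key : ∀ v : Fin n → ℝ,
        (fun j => ∑ r, 1 / 2 * P.normal r v / P.ell r x * (P.ν r j : ℝ)) = (P.hess x).mulVec v := by
      intro v
      funext j
      simp only [Matrix.mulVec, dotProduct, hess, Matrix.of_apply, normal_apply, Finset.mul_sum,
        Finset.sum_mul, Finset.sum_div]
      rw [Finset.sum_comm]
      exact Finset.sum_congr rfl fun k _ => Finset.sum_congr rfl fun r _ => by ring
    exact (key _).trans h

lemma exists_ell_le : ∃ C : ℝ, ∀ r, ∀ x ∈ P.inner, P.ell r x ≤ C := by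
  have hc : Continuous fun x => ∑ r, |P.ell r x| :=
    continuous_finsetSum _ fun r _ => (P.continuous_ell r).abs
  obtain ⟨C, hC⟩ := P.isCompact_carrier.exists_bound_of_continuousOn hc.continuousOn
  refine ⟨C, fun r x hx => ?_⟩
  have h1 := hC x (P.inner_subset_carrier hx)
  have h2 : |P.ell r x| ≤ ∑ r, |P.ell r x| :=
    Finset.single_le_sum (f := fun r => |P.ell r x|) (fun _ _ => abs_nonneg _) (Finset.mem_univ r)
  exact (le_abs_self _).trans (h2.trans ((le_abs_self _).trans h1))

lemma IsSmoothSection.continuousOn {P : DelzantPolytope n d} {τ : Phase n → ℂ}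
    (hτ : P.IsSmoothSection τ) : ContinuousOn τ P.openOrbit := by
  obtain ⟨F, hF, h⟩ := hτ
  obtain ⟨φ, hφ, hlift⟩ := P.exists_continuous_lift
  have hcont : Continuous fun q : Phase n =>
      Complex.exp (-(Complex.I * ∑ r, (P.lamL r : ℂ) * (φ q.2 r : ℂ))) *
        F (fun r => (Real.sqrt (P.ell r q.1) : ℂ) * Complex.exp (Complex.I * (φ q.2 r : ℂ))) := by
    have h1 : ∀ r, Continuous fun q : Phase n => φ q.2 r := fun r =>
      (continuous_apply r).comp (hφ.comp continuous_snd)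
    have h2 : ∀ r, Continuous fun q : Phase n => P.ell r q.1 := fun r =>
      (P.continuous_ell r).comp continuous_fst
    refine Continuous.mul (by fun_prop) (hF.continuous.comp (continuous_pi fun r => ?_))
    have := (h2 r).sqrt
    fun_prop
  refine hcont.continuousOn.congr fun q hq => ?_
  have := h q.1 hq (φ q.2)
  rw [hlift] at this
  simp only
  rw [this, ← mul_assoc, ← Complex.exp_add]
  simp

lemma IsSmoothSection.exists_norm_le {P : DelzantPolytope n d} {τ : Phase n → ℂ}
    (hτ : P.IsSmoothSection τ) : ∃ B : ℝ, 0 ≤ B ∧ ∀ q ∈ P.openOrbit, ‖τ q‖ ≤ B := by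
  obtain ⟨F, hF, h⟩ := hτ
  obtain ⟨φ, hφ, hlift⟩ := P.exists_continuous_lift
  obtain ⟨C, hC⟩ := P.exists_ell_le
  obtain ⟨B, hB⟩ := (isCompact_closedBall (0 : Fin d → ℂ)
    (Real.sqrt C)).exists_bound_of_continuousOn hF.continuous.continuousOn
  refine ⟨B, (norm_nonneg _).trans (hB 0 (by simp)), fun q hq => ?_⟩
  have := h q.1 hq (φ q.2)
  rw [hlift] at this
  have h1 : ‖Complex.exp (Complex.I * ∑ r, (P.lamL r : ℂ) * (φ q.2 r : ℂ))‖ = 1 := by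
    have : Complex.I * ∑ r, (P.lamL r : ℂ) * (φ q.2 r : ℂ) =
        ((∑ r, (P.lamL r : ℝ) * φ q.2 r : ℝ) : ℂ) * Complex.I := by
      push_cast; ring
    rw [this, Complex.norm_exp_ofReal_mul_I]
  have h2 := hB (fun r => (Real.sqrt (P.ell r q.1) : ℂ) *
    Complex.exp (Complex.I * (φ q.2 r : ℂ))) (by
      rw [mem_closedBall_zero_iff, pi_norm_le_iff_of_nonneg (Real.sqrt_nonneg _)]
      intro r
      rw [norm_mul, mul_comm Complex.I, Complex.norm_exp_ofReal_mul_I, mul_one, Complex.norm_real,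
        Real.norm_of_nonneg (Real.sqrt_nonneg _)]
      exact Real.sqrt_le_sqrt (hC r q.1 hq))
  rw [this, norm_mul, h1, one_mul] at h2
  exact h2

lemma measurableSet_fundDomain : MeasurableSet P.fundDomain := by
  have : P.fundDomain = P.inner ×ˢ (Set.univ.pi fun _ => Set.Ico 0 (2 * Real.pi)) := by
    ext q; simp [fundDomain]
  rw [this]
  exact P.isOpen_inner.measurableSet.prod
    (MeasurableSet.pi Set.countable_univ fun _ _ => measurableSet_Ico)

lemma exists_fundDomain_subset : ∃ R : ℝ, 0 ≤ R ∧ P.fundDomain ⊆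
    {q | ‖q.1‖ ≤ R ∧ ‖q.2‖ ≤ 2 * Real.pi} := by
  obtain ⟨R, hR⟩ := P.isCompact_carrier.isBounded.exists_norm_le
  obtain ⟨x, hx⟩ := P.inner_nonempty
  refine ⟨R, (norm_nonneg _).trans (hR x (P.inner_subset_carrier hx)), fun q hq =>
    ⟨hR _ (P.inner_subset_carrier hq.1), ?_⟩⟩
  rw [pi_norm_le_iff_of_nonneg Real.two_pi_pos.le]
  intro j
  rw [Real.norm_of_nonneg (hq.2 j).1]
  exact (hq.2 j).2.le

lemma fundDomain_subset_openOrbit : P.fundDomain ⊆ P.openOrbit := fun _ hq => hq.1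

/-- The kernel `e^{i m·θ} conj τ`, common to all pairings with the test section `τ`. -/
noncomputable def testKernel (m : Fin n → ℤ) (τ : Phase n → ℂ) (q : Phase n) : ℂ :=
  Complex.exp (Complex.I * ∑ j, (m j : ℂ) * (q.2 j : ℂ)) * (starRingEnd ℂ) (τ q)

lemma norm_testKernel (m : Fin n → ℤ) (τ : Phase n → ℂ) (q : Phase n) :
    ‖testKernel m τ q‖ = ‖τ q‖ := by
  have : Complex.I * ∑ j, (m j : ℂ) * (q.2 j : ℂ) =
      ((∑ j, (m j : ℝ) * q.2 j : ℝ) : ℂ) * Complex.I := by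
    push_cast; ring
  rw [testKernel, norm_mul, this, Complex.norm_exp_ofReal_mul_I, one_mul, RCLike.norm_conj]

lemma continuousOn_testKernel (m : Fin n → ℤ) (τ : P.testSections) :
    ContinuousOn (testKernel m τ.1) P.openOrbit := by
  unfold testKernel
  exact ContinuousOn.mul (by fun_prop)
    (Complex.continuous_conj.comp_continuousOn (IsSmoothSection.continuousOn τ.2))

/-- The pairing of `σ` with test sections is given over the open orbit by the function `g(x)` times
the kernel of the Fourier mode `m`, and `g` is continuous and bounded by `C`. -/
structure IsPairedBy (σ : HalfFormSection n) (m : Fin n → ℤ) (g : (Fin n → ℝ) → ℝ) (C : ℝ) :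
    Prop where
  eq : ∀ (τ : Phase n → ℂ), ∀ q ∈ P.openOrbit,
    P.pointPairing σ τ q = (g q.1 : ℂ) * testKernel m τ q
  continuousOn : ContinuousOn g P.inner
  norm_le : ∀ x ∈ P.inner, ‖g x‖ ≤ C

section IsPairedBy

variable {P} {σ : HalfFormSection n} {m : Fin n → ℤ} {g : (Fin n → ℝ) → ℝ} {C : ℝ}
  {V : Type*} [TopologicalSpace V] [MeasurableSpace V] [OpensMeasurableSpace V]
  {μ : MeasureTheory.Measure V} {ι : V → Phase n}

lemma IsPairedBy.norm_pointPairing_le (h : P.IsPairedBy σ m g C) {τ : Phase n → ℂ} {c : ℝ}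
    (hτ : ∀ q ∈ P.openOrbit, ‖τ q‖ ≤ c) {q : Phase n} (hq : q ∈ P.openOrbit) :
    ‖P.pointPairing σ τ q‖ ≤ C * c := by
  rw [h.eq τ q hq, norm_mul, norm_testKernel, Complex.norm_real]
  exact mul_le_mul (h.norm_le _ hq) (hτ q hq) (norm_nonneg _)
    ((norm_nonneg _).trans (h.norm_le _ hq))

lemma IsPairedBy.integrableOn (h : P.IsPairedBy σ m g C) (hι : Continuous ι)
    (hμ : μ (ι ⁻¹' P.fundDomain) ≠ ⊤) (τ : P.testSections) :
    MeasureTheory.IntegrableOn (fun v => P.pointPairing σ τ.1 (ι v)) (ι ⁻¹' P.fundDomain) μ := by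
  have hD : MeasurableSet (ι ⁻¹' P.fundDomain) := hι.measurable P.measurableSet_fundDomain
  obtain ⟨B, hB0, hB⟩ := IsSmoothSection.exists_norm_le τ.2
  have hcont : ContinuousOn (fun v => P.pointPairing σ τ.1 (ι v)) (ι ⁻¹' P.fundDomain) := by
    have h1 : ContinuousOn (fun q : Phase n => (g q.1 : ℂ) * testKernel m τ.1 q) P.openOrbit :=
      (Complex.continuous_ofReal.comp_continuousOn
        (h.continuousOn.comp continuousOn_fst fun q hq => hq)).mul (P.continuousOn_testKernel m τ)
    refine (h1.comp hι.continuousOn fun v hv => P.fundDomain_subset_openOrbit hv).congr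
      fun v hv => h.eq τ.1 _ (P.fundDomain_subset_openOrbit hv)
  have : MeasureTheory.IsFiniteMeasure (μ.restrict (ι ⁻¹' P.fundDomain)) :=
    ⟨by rw [MeasureTheory.Measure.restrict_apply_univ]; exact hμ.lt_top⟩
  refine MeasureTheory.Integrable.of_bound (hcont.aestronglyMeasurable hD) (C * B) ?_
  filter_upwards [MeasureTheory.ae_restrict_mem hD] with v hv
  exact h.norm_pointPairing_le hB (P.fundDomain_subset_openOrbit hv)

/-- Integration of the pairing with a section paired by a bounded function defines a distributional
section. -/
lemma IsPairedBy.isDistributionalSection (h : P.IsPairedBy σ m g C) (hι : Continuous ι)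
    (hμ : μ (ι ⁻¹' P.fundDomain) ≠ ⊤) (a : ℂ) :
    P.IsDistributionalSection fun τ =>
      a * ∫ v in ι ⁻¹' P.fundDomain, P.pointPairing σ τ.1 (ι v) ∂μ := by
  refine ⟨fun c τ τ' => ?_, ‖a‖ * (C * μ.real (ι ⁻¹' P.fundDomain)), fun τ c hc => ?_⟩
  · have h1 : ∀ v, P.pointPairing σ (c • τ + τ').1 (ι v) =
        (starRingEnd ℂ) c * P.pointPairing σ τ.1 (ι v) + P.pointPairing σ τ'.1 (ι v) := by
      intro v
      simp only [pointPairing, Submodule.coe_add, Submodule.coe_smul, Pi.add_apply, Pi.smul_apply,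
        smul_eq_mul, map_add, map_mul]
      ring
    simp only [h1]
    rw [MeasureTheory.integral_add ((h.integrableOn hι hμ τ).const_mul _)
      (h.integrableOn hι hμ τ'), MeasureTheory.integral_const_mul]
    ring
  · rw [norm_mul, mul_assoc, mul_assoc]
    refine mul_le_mul_of_nonneg_left ?_ (norm_nonneg _)
    refine (MeasureTheory.norm_setIntegral_le_of_norm_le_const hμ.lt_top fun v hv =>
      h.norm_pointPairing_le hc (P.fundDomain_subset_openOrbit hv)).trans (le_of_eq (by ring))

end IsPairedBy

lemma exists_density_le {m : Fin n → ℤ} (hm : (fun j => (m j : ℝ)) ∈ P.carrier)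
    {K : Set ((Fin n → ℝ) × (Fin n → ℝ))} (hK : IsCompact K) :
    ∃ C : ℝ, ∀ a ∈ K, ∀ x ∈ P.carrier, ‖P.density m a.1 a.2 x‖ ≤ C := by
  have hcont : ContinuousOn (fun a : ((Fin n → ℝ) × (Fin n → ℝ)) × (Fin n → ℝ) =>
      P.density m a.1.1 a.1.2 a.2) (K ×ˢ P.carrier) :=
    (P.continuousOn_density hm).comp
      (f := fun a : ((Fin n → ℝ) × (Fin n → ℝ)) × (Fin n → ℝ) => (a.1.1, a.1.2, a.2))
      (by fun_prop) fun a ha => ha.2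
  obtain ⟨C, hC⟩ := (hK.prod P.isCompact_carrier).exists_bound_of_continuousOn hcont
  exact ⟨C, fun a ha x hx => hC (a, x) ⟨ha, hx⟩⟩

lemma continuousOn_density_const {m : Fin n → ℤ} (hm : (fun j => (m j : ℝ)) ∈ P.carrier)
    (c e : Fin n → ℝ) : ContinuousOn (P.density m c e) P.inner :=
  (P.continuousOn_density hm).comp (f := fun x : Fin n → ℝ => (c, e, x))
    (by fun_prop) fun _ hx => P.inner_subset_carrier hx

lemma continuous_hamiltonian_sub (p : ℕ) (m : Fin n → ℤ) :
    Continuous fun x : Fin n → ℝ => hamiltonian p fun j => x j - m j := by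
  unfold hamiltonian
  refine continuous_const.mul (continuous_finsetSum _ fun j _ => ?_)
  split_ifs <;> fun_prop

lemma hamiltonian_nonneg (p : ℕ) (x : Fin n → ℝ) : 0 ≤ hamiltonian p x := by
  unfold hamiltonian
  refine mul_nonneg (by norm_num) (Finset.sum_nonneg fun j _ => ?_)
  split_ifs <;> positivity

lemma isPairedBy_gcst {m : Fin n → ℤ} (hm : (fun j => (m j : ℝ)) ∈ P.carrier) (p : ℕ) {s : ℝ}
    (hs : 0 ≤ s) : ∃ C, P.IsPairedBy (gcst p s (P.monomialSection m)) m
      (fun x => Real.exp (-s * hamiltonian p fun j => x j - m j) *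
        P.density m (fun _ => 1) (headCoeff₀ n p s) x) C := by
  obtain ⟨C, hC⟩ := P.exists_density_le hm
    (isCompact_singleton (x := ((fun _ => 1 : Fin n → ℝ), headCoeff₀ n p s)))
  refine ⟨C, fun τ q hq => ?_, ?_, fun x hx => ?_⟩
  · exact P.pointPairing_eq hq (P.gcst_coeff p m s hq) (fun _ => zero_le_one)
      (headCoeff₀_nonneg hs) (P.gcst_form_eq_mixedForm p m s hq) τ
  · exact (Real.continuous_exp.comp (continuous_const.mul
      (continuous_hamiltonian_sub p m))).continuousOn.mul (P.continuousOn_density_const hm _ _)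
  · rw [norm_mul, Real.norm_of_nonneg (Real.exp_pos _).le]
    refine (mul_le_of_le_one_left (norm_nonneg _) (Real.exp_le_one_iff.2 ?_)).trans
      (hC _ rfl x (P.inner_subset_carrier hx))
    have := hamiltonian_nonneg p fun j => x j - (m j : ℝ)
    nlinarith

lemma isPairedBy_limitDensity {m : Fin n → ℤ} (hm : (fun j => (m j : ℝ)) ∈ P.carrier) (p : ℕ) :
    ∃ C, P.IsPairedBy (P.limitDensity p m) m
      (P.density m (headCoeff n p 0) (headCoeff₀ n p 1)) C := by
  obtain ⟨C, hC⟩ := P.exists_density_le hm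
    (isCompact_singleton (x := (headCoeff n p 0, headCoeff₀ n p 1)))
  refine ⟨C, fun τ q hq => ?_, P.continuousOn_density_const hm _ _, fun x hx =>
    hC _ rfl x (P.inner_subset_carrier hx)⟩
  have h := P.pointPairing_eq (m := m) (σ := P.limitDensity p m) hq (a := 1)
    (by rw [limitDensity_coeff, monomialSection_coeff, Complex.ofReal_one, one_mul])
    (headCoeff_nonneg le_rfl) (headCoeff₀_nonneg zero_le_one) (P.dXdZ_eq_mixedForm p hq) τ
  rwa [one_mul] at h

lemma volume_fundDomain_ne_top : MeasureTheory.volume P.fundDomain ≠ ⊤ := by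
  obtain ⟨R, -, hR⟩ := P.exists_fundDomain_subset
  refine ((MeasureTheory.measure_mono hR).trans_lt ?_).ne
  have : {q : Phase n | ‖q.1‖ ≤ R ∧ ‖q.2‖ ≤ 2 * Real.pi} =
      Metric.closedBall 0 R ×ˢ Metric.closedBall 0 (2 * Real.pi) := by
    ext q; simp
  rw [this]
  exact ((isCompact_closedBall _ _).prod (isCompact_closedBall _ _)).measure_lt_top

lemma continuous_glue (p : ℕ) (c : Fin n → ℝ) : Continuous (glue p c) := by
  refine continuous_pi fun j => ?_
  unfold glue
  split_ifs <;> fun_prop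

/-- The point of phase space with the actions `x_j = b_j` for `j ≤ p` and with the remaining actions
and the angles given by `w`. -/
def assemble {p : ℕ} (b : {j : Fin n // ¬ p ≤ j.val} → ℝ)
    (w : ({j : Fin n // p ≤ j.val} → ℝ) × (Fin n → ℝ)) : Phase n :=
  (fun j => if h : p ≤ j.val then w.1 ⟨j, h⟩ else b ⟨j, h⟩, w.2)

/-- A box in `(x_{p+1}, …, x_n, θ)` containing the projection of the fundamental domain. -/
def sliceBox (n p : ℕ) (R : ℝ) : Set (({j : Fin n // p ≤ j.val} → ℝ) × (Fin n → ℝ)) :=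
  Metric.closedBall 0 R ×ˢ Metric.closedBall 0 (2 * Real.pi)

lemma mem_sliceBox {p : ℕ} {R : ℝ} (hR0 : 0 ≤ R)
    (hR : P.fundDomain ⊆ {q | ‖q.1‖ ≤ R ∧ ‖q.2‖ ≤ 2 * Real.pi})
    {b : {j : Fin n // ¬ p ≤ j.val} → ℝ}
    {w : ({j : Fin n // p ≤ j.val} → ℝ) × (Fin n → ℝ)} (hw : assemble b w ∈ P.fundDomain) :
    w ∈ sliceBox n p R := by
  have h := hR hw
  refine ⟨?_, by simpa [assemble] using h.2⟩
  rw [mem_closedBall_zero_iff, pi_norm_le_iff_of_nonneg hR0]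
  intro j
  have := (norm_le_pi_norm (assemble b w).1 j.1).trans h.1
  simpa [assemble, j.2] using this

lemma volume_sliceBox_lt_top (p : ℕ) (R : ℝ) :
    MeasureTheory.volume (sliceBox n p R) < ⊤ :=
  ((isCompact_closedBall _ _).prod (isCompact_closedBall _ _)).measure_lt_top

lemma volume_sliceDomain_ne_top (p : ℕ) (c : Fin n → ℝ) :
    MeasureTheory.volume (P.sliceDomain p c) ≠ ⊤ := by
  obtain ⟨R, hR0, hR⟩ := P.exists_fundDomain_subset
  exact ((MeasureTheory.measure_mono fun v hv =>
    P.mem_sliceBox (b := fun i => c i.1) hR0 hR hv).trans_lt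
    (volume_sliceBox_lt_top p R)).ne

end DelzantPolytope

/-! ### Concentration of the Gaussian factor -/

lemma integral_gaussian_pi {ι : Type*} [Fintype ι] :
    ∫ b : ι → ℝ, Real.exp (-(1 / 2) * ∑ i, b i ^ 2) =
      Real.sqrt (2 * Real.pi) ^ Fintype.card ι := by
  have h : ∀ b : ι → ℝ, Real.exp (-(1 / 2) * ∑ i, b i ^ 2) =
      ∏ i, Real.exp (-(1 / 2) * b i ^ 2) := by
    intro b; rw [Finset.mul_sum, Real.exp_sum]
  simp only [h]
  rw [MeasureTheory.integral_fintype_prod_volume_eq_pow (fun x : ℝ => Real.exp (-(1 / 2) * x ^ 2)),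
    integral_gaussian]
  congr 2
  ring

lemma integrable_gaussian_pi {ι : Type*} [Fintype ι] :
    MeasureTheory.Integrable fun b : ι → ℝ => Real.exp (-(1 / 2) * ∑ i, b i ^ 2) := by
  have h : ∀ b : ι → ℝ, Real.exp (-(1 / 2) * ∑ i, b i ^ 2) =
      ∏ i, Real.exp (-(1 / 2) * b i ^ 2) := by
    intro b; rw [Finset.mul_sum, Real.exp_sum]
  simp only [h]
  exact MeasureTheory.Integrable.fintype_prod fun _ => integrable_exp_neg_mul_sq (by norm_num)

namespace DelzantPolytope

variable {n d : ℕ} (P : DelzantPolytope n d)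

/-- The first `p` coordinates of `m`. -/
def headPoint (m : Fin n → ℤ) (p : ℕ) : {j : Fin n // ¬ p ≤ j.val} → ℝ := fun i => m i.1

lemma continuous_assemble {p : ℕ} : Continuous fun z : ({j : Fin n // ¬ p ≤ j.val} → ℝ) ×
    (({j : Fin n // p ≤ j.val} → ℝ) × (Fin n → ℝ)) => assemble z.1 z.2 := by
  unfold assemble
  refine Continuous.prodMk (continuous_pi fun j => ?_) (by fun_prop)
  split_ifs <;> fun_prop

lemma integral_assemble (p : ℕ) {f : Phase n → ℂ} (hf : MeasureTheory.Integrable f) :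
    ∫ q, f q = ∫ b : {j : Fin n // ¬ p ≤ j.val} → ℝ,
      ∫ w : ({j : Fin n // p ≤ j.val} → ℝ) × (Fin n → ℝ), f (assemble b w) := by
  let e₁ : (({j : Fin n // ¬ p ≤ j.val} → ℝ) × ({j : Fin n // p ≤ j.val} → ℝ)) ≃ᵐ (Fin n → ℝ) :=
    MeasurableEquiv.prodComm.trans
      (MeasurableEquiv.piEquivPiSubtypeProd (fun _ : Fin n => ℝ) (fun j => p ≤ j.val)).symm
  have h₁ : MeasureTheory.MeasurePreserving e₁ :=
    MeasureTheory.Measure.measurePreserving_swap.trans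
      (MeasureTheory.volume_preserving_piEquivPiSubtypeProd (fun _ : Fin n => ℝ)
        (fun j => p ≤ j.val)).symm
  let e : (({j : Fin n // ¬ p ≤ j.val} → ℝ) ×
      (({j : Fin n // p ≤ j.val} → ℝ) × (Fin n → ℝ))) ≃ᵐ Phase n :=
    MeasurableEquiv.prodAssoc.symm.trans (e₁.prodCongr (MeasurableEquiv.refl _))
  have h : MeasureTheory.MeasurePreserving e :=
    MeasureTheory.volume_preserving_prodAssoc.symm.trans
      (h₁.prod (MeasureTheory.MeasurePreserving.id _))
  have he : ∀ z, e z = assemble z.1 z.2 := fun z => rfl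
  rw [← h.integral_comp' f]
  simp only [he]
  refine MeasureTheory.integral_prod _ ?_
  have := (h.integrable_comp_emb e.measurableEmbedding).2 hf
  exact this

/-- The slice through `m` meets the boundary of `P` in a null set. -/
lemma ae_ell_glue_ne_zero {c : Fin n → ℝ} (hc : ∀ r, 0 < P.ell r c) (p : ℕ) :
    ∀ᵐ w : ({j : Fin n // p ≤ j.val} → ℝ) × (Fin n → ℝ), ∀ r, P.ell r (glue p c w.1) ≠ 0 := by
  have hnull : ∀ r, ∀ᵐ u : {j : Fin n // p ≤ j.val} → ℝ, P.ell r (glue p c u) ≠ 0 := by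
    intro r
    let A : AffineSubspace ℝ ({j : Fin n // p ≤ j.val} → ℝ) :=
      { carrier := {u | P.ell r (glue p c u) = 0}
        smul_vsub_vadd_mem' := by
          intro t u₁ u₂ u₃ h₁ h₂ h₃
          simp only [Set.mem_ofPred_eq] at *
          have hg : glue p c (t • (u₁ -ᵥ u₂) +ᵥ u₃) =
              t • (glue p c u₁ - glue p c u₂) + glue p c u₃ := by
            funext j
            by_cases hj : p ≤ j.val <;> simp [glue, hj]
          rw [ell_eq] at h₁ h₂ h₃ ⊢
          rw [hg, map_add, map_smul, map_sub, smul_eq_mul]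
          linear_combination t * h₁ - t * h₂ + h₃ }
    have hA : A ≠ ⊤ := by
      intro h
      have : (fun j => c j.1) ∈ A := by rw [h]; trivial
      have h0 : P.ell r (glue p c fun j => c j.1) = 0 := this
      have hg : glue p c (fun j => c j.1) = c := by
        funext j
        by_cases hj : p ≤ j.val <;> simp [glue, hj]
      rw [hg] at h0
      exact (hc r).ne' h0
    have := MeasureTheory.Measure.addHaar_affineSubspace MeasureTheory.volume A hA
    rw [MeasureTheory.ae_iff]
    refine MeasureTheory.measure_mono_null (fun u hu => ?_) this
    exact not_not.1 hu
  rw [MeasureTheory.ae_all_iff]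
  intro r
  exact MeasureTheory.Measure.quasiMeasurePreserving_fst.ae (hnull r)

/-- The pairing density of `s^{-p/2} U_s σ^m`, without its Gaussian factor, at `t = 1/s`, extended
by zero from the fundamental domain. -/
noncomputable def rescaledPairing (m : Fin n → ℤ) (p : ℕ) (τ : Phase n → ℂ) (t : ℝ) :
    Phase n → ℂ :=
  P.fundDomain.indicator fun q =>
    (P.density m (headCoeff n p t) (headCoeff₀ n p 1) q.1 : ℂ) * testKernel m τ q

section Limit

variable {P} {m : Fin n → ℤ}

lemma measurable_rescaledPairing (hm : (fun j => (m j : ℝ)) ∈ P.carrier) (p : ℕ)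
    (τ : P.testSections) (t : ℝ) : Measurable (P.rescaledPairing m p τ.1 t) := by
  classical
  have hcont : ContinuousOn (fun q : Phase n =>
      (P.density m (headCoeff n p t) (headCoeff₀ n p 1) q.1 : ℂ) * testKernel m τ.1 q)
      P.fundDomain :=
    ((Complex.continuous_ofReal.comp_continuousOn
      ((P.continuousOn_density_const hm _ _).comp continuousOn_fst fun q hq => hq)).mul
      (P.continuousOn_testKernel m τ)).mono P.fundDomain_subset_openOrbit
  have := hcont.measurable_piecewise (g := fun _ => (0 : ℂ)) continuousOn_const
    P.measurableSet_fundDomain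
  have h := Set.piecewise_eq_indicator (s := P.fundDomain) (f := fun q : Phase n =>
    (P.density m (headCoeff n p t) (headCoeff₀ n p 1) q.1 : ℂ) * testKernel m τ.1 q)
  rw [rescaledPairing, ← h]
  exact this

lemma exists_norm_rescaledPairing_le (hm : (fun j => (m j : ℝ)) ∈ P.carrier) (p : ℕ)
    (τ : P.testSections) : ∃ C : ℝ, 0 ≤ C ∧ ∀ t ∈ Set.Icc (0 : ℝ) 1, ∀ q,
    ‖P.rescaledPairing m p τ.1 t q‖ ≤ C := by
  obtain ⟨C, hC⟩ := P.exists_density_le hm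
    ((isCompact_Icc (a := (0 : ℝ)) (b := 1)).image
      (f := fun t => (headCoeff n p t, headCoeff₀ n p 1))
      ((continuous_headCoeff p).prodMk continuous_const))
  obtain ⟨B, hB0, hB⟩ := IsSmoothSection.exists_norm_le τ.2
  obtain ⟨x, hx⟩ := P.inner_nonempty
  have hC0 : 0 ≤ C := (norm_nonneg _).trans
    (hC _ ⟨0, ⟨le_rfl, zero_le_one⟩, rfl⟩ x (P.inner_subset_carrier hx))
  refine ⟨C * B, by positivity, fun t ht q => ?_⟩
  rw [rescaledPairing]
  by_cases hq : q ∈ P.fundDomain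
  · rw [Set.indicator_of_mem hq, norm_mul, norm_testKernel, Complex.norm_real]
    exact mul_le_mul (hC _ ⟨t, ht, rfl⟩ _ (P.inner_subset_carrier hq.1))
      (hB _ (P.fundDomain_subset_openOrbit hq)) (norm_nonneg _) hC0
  · rw [Set.indicator_of_notMem hq, norm_zero]
    positivity

/-- Pointwise convergence away from the boundary of `P`: over the interior the density is continuous
in `t` and `x`, and outside `P` it vanishes near the limit point. -/
lemma tendsto_rescaledPairing (hm : (fun j => (m j : ℝ)) ∈ P.carrier) (p : ℕ)
    (τ : P.testSections) {t : ℝ → ℝ} (ht : Filter.Tendsto t Filter.atTop (nhds 0))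
    {b : ℝ → {j : Fin n // ¬ p ≤ j.val} → ℝ}
    (hb : Filter.Tendsto b Filter.atTop (nhds (headPoint m p)))
    {w : ({j : Fin n // p ≤ j.val} → ℝ) × (Fin n → ℝ)}
    (hw : ∀ r, P.ell r (glue p (fun j => (m j : ℝ)) w.1) ≠ 0) :
    Filter.Tendsto (fun s => P.rescaledPairing m p τ.1 (t s) (assemble (b s) w)) Filter.atTop
      (nhds (P.rescaledPairing m p τ.1 0 (assemble (headPoint m p) w))) := by
  set q₀ : Phase n := assemble (headPoint m p) w with hq₀
  have hq₀' : q₀.1 = glue p (fun j => (m j : ℝ)) w.1 := rfl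
  have hlim : Filter.Tendsto (fun s => assemble (b s) w) Filter.atTop (nhds q₀) :=
    (continuous_assemble.tendsto (headPoint m p, w)).comp (hb.prodMk_nhds tendsto_const_nhds)
  have hlim1 : Filter.Tendsto (fun s => (assemble (b s) w).1) Filter.atTop (nhds q₀.1) :=
    (continuous_fst.tendsto q₀).comp hlim
  by_cases hθ : ∀ j, w.2 j ∈ Set.Ico 0 (2 * Real.pi)
  · by_cases hin : q₀.1 ∈ P.inner
    · have hev : ∀ᶠ s in Filter.atTop, (assemble (b s) w).1 ∈ P.inner :=
        hlim1.eventually (P.isOpen_inner.mem_nhds hin)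
      have h1 : Filter.Tendsto (fun s => P.density m (headCoeff n p (t s)) (headCoeff₀ n p 1)
          (assemble (b s) w).1) Filter.atTop
          (nhds (P.density m (headCoeff n p 0) (headCoeff₀ n p 1) q₀.1)) := by
        have h2 := P.continuousOn_density hm (headCoeff n p 0, headCoeff₀ n p 1, q₀.1)
          (P.inner_subset_carrier hin)
        refine h2.tendsto.comp (f := fun s => (headCoeff n p (t s), headCoeff₀ n p 1,
          (assemble (b s) w).1)) (tendsto_nhdsWithin_iff.2 ⟨?_, ?_⟩)
        · exact (((continuous_headCoeff p).tendsto 0).comp ht).prodMk_nhds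
            (tendsto_const_nhds.prodMk_nhds hlim1)
        · filter_upwards [hev] with s hs using P.inner_subset_carrier hs
      have h2 : Filter.Tendsto (fun s => testKernel m τ.1 (assemble (b s) w)) Filter.atTop
          (nhds (testKernel m τ.1 q₀)) :=
        ((P.continuousOn_testKernel m τ).continuousAt
          (P.isOpen_openOrbit.mem_nhds hin)).tendsto.comp hlim
      have h3 := ((Complex.continuous_ofReal.tendsto _).comp h1).mul h2
      have hmem : q₀ ∈ P.fundDomain := ⟨hin, hθ⟩
      rw [rescaledPairing, Set.indicator_of_mem hmem]
      refine h3.congr' ?_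
      filter_upwards [hev] with s hs
      have hmem' : assemble (b s) w ∈ P.fundDomain := ⟨hs, hθ⟩
      rw [rescaledPairing, Set.indicator_of_mem hmem']
      rfl
    · have : ∃ r, P.ell r q₀.1 < 0 := by
        by_contra! hc
        exact hin fun r => lt_of_le_of_ne (hc r) (by rw [hq₀']; exact (hw r).symm)
      obtain ⟨r, hr⟩ := this
      have hev : ∀ᶠ s in Filter.atTop, P.ell r (assemble (b s) w).1 < 0 :=
        (((P.continuous_ell r).tendsto _).comp hlim1).eventually (gt_mem_nhds hr)
      rw [rescaledPairing, Set.indicator_of_notMem fun h => hin h.1]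
      refine tendsto_const_nhds.congr' ?_
      filter_upwards [hev] with s hs
      rw [rescaledPairing, Set.indicator_of_notMem fun h => (h.1 r).not_gt hs]
  · have h : ∀ t b, P.rescaledPairing m p τ.1 t (assemble b w) = 0 := fun t b => by
      rw [rescaledPairing, Set.indicator_of_notMem fun h => hθ h.2]
    simp only [hq₀, h]
    exact tendsto_const_nhds

/-- The integral over the fibre of the first `p` actions is continuous at `x_j = m_j`, `t = 0`. -/
lemma tendsto_integral_rescaledPairing (hm : (fun j => (m j : ℝ)) ∈ P.carrier) (p : ℕ)
    (τ : P.testSections) {t : ℝ → ℝ}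
    (ht : Filter.Tendsto t Filter.atTop (nhds 0))
    (ht' : ∀ᶠ s in Filter.atTop, t s ∈ Set.Icc (0 : ℝ) 1)
    {b : ℝ → {j : Fin n // ¬ p ≤ j.val} → ℝ}
    (hb : Filter.Tendsto b Filter.atTop (nhds (headPoint m p))) :
    Filter.Tendsto (fun s => ∫ w, P.rescaledPairing m p τ.1 (t s) (assemble (b s) w)) Filter.atTop
      (nhds (∫ w, P.rescaledPairing m p τ.1 0 (assemble (headPoint m p) w))) := by
  obtain ⟨C, hC0, hC⟩ := exists_norm_rescaledPairing_le hm p τ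
  obtain ⟨R, hR0, hR⟩ := P.exists_fundDomain_subset
  have hmeasBox : MeasurableSet (sliceBox n p R) :=
    Metric.isClosed_closedBall.measurableSet.prod Metric.isClosed_closedBall.measurableSet
  refine MeasureTheory.tendsto_integral_filter_of_dominated_convergence
    ((sliceBox n p R).indicator fun _ => C) ?_ ?_ ?_ ?_
  · refine Filter.Eventually.of_forall fun s => ?_
    exact ((measurable_rescaledPairing hm p τ (t s)).comp (continuous_assemble.comp
      (f := fun w => (b s, w)) (by fun_prop)).measurable).aestronglyMeasurable
  · filter_upwards [ht'] with s hs
    refine Filter.Eventually.of_forall fun w => ?_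
    by_cases hw : w ∈ sliceBox n p R
    · rw [Set.indicator_of_mem hw]
      exact hC _ hs _
    · rw [Set.indicator_of_notMem hw, rescaledPairing,
        Set.indicator_of_notMem fun h => hw (P.mem_sliceBox hR0 hR h), norm_zero]
  · exact (MeasureTheory.integrable_indicator_iff hmeasBox).2
      (MeasureTheory.integrableOn_const (volume_sliceBox_lt_top p R).ne)
  · filter_upwards [P.ae_ell_glue_ne_zero (c := fun j => (m j : ℝ))
      (fun r => by linarith [P.half_le_ell hm r]) p] with w hw
    exact tendsto_rescaledPairing hm p τ ht hb hw

lemma exists_norm_integral_rescaledPairing_le (hm : (fun j => (m j : ℝ)) ∈ P.carrier) (p : ℕ)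
    (τ : P.testSections) : ∃ C : ℝ, ∀ t ∈ Set.Icc (0 : ℝ) 1,
    ∀ b : {j : Fin n // ¬ p ≤ j.val} → ℝ,
    ‖∫ w, P.rescaledPairing m p τ.1 t (assemble b w)‖ ≤ C := by
  obtain ⟨C, hC0, hC⟩ := exists_norm_rescaledPairing_le hm p τ
  obtain ⟨R, hR0, hR⟩ := P.exists_fundDomain_subset
  refine ⟨C * MeasureTheory.volume.real (sliceBox n p R), fun t ht b => ?_⟩
  rw [← MeasureTheory.setIntegral_eq_integral_of_forall_compl_eq_zero (s := sliceBox n p R)]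
  · exact MeasureTheory.norm_setIntegral_le_of_norm_le_const (volume_sliceBox_lt_top p R)
      fun w _ => hC t ht _
  · intro w hw
    rw [rescaledPairing, Set.indicator_of_notMem fun h => hw (P.mem_sliceBox hR0 hR h)]

/-- The Gaussian factor concentrates at `x_j = m_j`, `j ≤ p`. -/
lemma tendsto_integral_gaussian_rescaledPairing (hm : (fun j => (m j : ℝ)) ∈ P.carrier) (p : ℕ)
    (τ : P.testSections) :
    Filter.Tendsto (fun s : ℝ => ∫ b : {j : Fin n // ¬ p ≤ j.val} → ℝ,
      (Real.exp (-(1 / 2) * ∑ i, b i ^ 2) : ℂ) *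
        ∫ w, P.rescaledPairing m p τ.1 s⁻¹
          (assemble ((headPoint m p) + (Real.sqrt s)⁻¹ • b) w)) Filter.atTop
      (nhds (∫ b : {j : Fin n // ¬ p ≤ j.val} → ℝ, (Real.exp (-(1 / 2) * ∑ i, b i ^ 2) : ℂ) *
        ∫ w, P.rescaledPairing m p τ.1 0 (assemble (headPoint m p) w))) := by
  obtain ⟨C, hC⟩ := exists_norm_integral_rescaledPairing_le hm p τ
  have hev : ∀ᶠ s : ℝ in Filter.atTop, s⁻¹ ∈ Set.Icc (0 : ℝ) 1 := by
    filter_upwards [Filter.eventually_ge_atTop 1] with s hs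
    exact ⟨by positivity, inv_le_one_of_one_le₀ hs⟩
  refine MeasureTheory.tendsto_integral_filter_of_dominated_convergence
    (fun b => Real.exp (-(1 / 2) * ∑ i, b i ^ 2) * C) ?_ ?_ (integrable_gaussian_pi.mul_const C) ?_
  · refine Filter.Eventually.of_forall fun s => ?_
    have h1 : Measurable fun z : ({j : Fin n // ¬ p ≤ j.val} → ℝ) ×
        (({j : Fin n // p ≤ j.val} → ℝ) × (Fin n → ℝ)) => P.rescaledPairing m p τ.1 s⁻¹
          (assemble ((headPoint m p) + (Real.sqrt s)⁻¹ • z.1) z.2) :=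
      (measurable_rescaledPairing hm p τ s⁻¹).comp (continuous_assemble.comp
        (f := fun z : ({j : Fin n // ¬ p ≤ j.val} → ℝ) ×
        (({j : Fin n // p ≤ j.val} → ℝ) × (Fin n → ℝ)) =>
          ((headPoint m p) + (Real.sqrt s)⁻¹ • z.1, z.2)) (by fun_prop)).measurable
    have h2 := h1.stronglyMeasurable.integral_prod_right'
      (ν := (MeasureTheory.volume : MeasureTheory.Measure
        (({j : Fin n // p ≤ j.val} → ℝ) × (Fin n → ℝ))))
    have h3 : Measurable fun b : {j : Fin n // ¬ p ≤ j.val} → ℝ =>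
        (Real.exp (-(1 / 2) * ∑ i, b i ^ 2) : ℂ) := by fun_prop
    exact (h3.stronglyMeasurable.mul h2).aestronglyMeasurable
  · filter_upwards [hev] with s hs
    refine Filter.Eventually.of_forall fun b => ?_
    rw [norm_mul, Complex.norm_real, Real.norm_of_nonneg (Real.exp_pos _).le]
    exact mul_le_mul_of_nonneg_left (hC _ hs _) (Real.exp_pos _).le
  · refine Filter.Eventually.of_forall fun b => ?_
    refine tendsto_const_nhds.mul (tendsto_integral_rescaledPairing hm p τ tendsto_inv_atTop_zero
      hev ?_)
    have h1 : Filter.Tendsto (fun s : ℝ => (Real.sqrt s)⁻¹ • b) Filter.atTop (nhds ((0 : ℝ) • b)) :=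
      (tendsto_inv_atTop_zero.comp Real.tendsto_sqrt_atTop).smul_const b
    rw [zero_smul] at h1
    simpa using (tendsto_const_nhds (x := headPoint m p)).add h1

lemma card_not_le {p : ℕ} (hp : p ≤ n) : Fintype.card {j : Fin n // ¬ p ≤ j.val} = p := by
  simp only [not_le]
  exact Fintype.card_fin_lt_of_le hp

end Limit

end DelzantPolytope

/-! ### The limit of the transform -/

namespace DelzantPolytope

variable {n d : ℕ} {P : DelzantPolytope n d} {m : Fin n → ℤ}

lemma hamiltonian_assemble (p : ℕ) (b : {j : Fin n // ¬ p ≤ j.val} → ℝ)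
    (w : ({j : Fin n // p ≤ j.val} → ℝ) × (Fin n → ℝ)) :
    hamiltonian p (fun j => (assemble b w).1 j - m j) =
      (1 / 2) * ∑ i, (b i - headPoint m p i) ^ 2 := by
  rw [hamiltonian]
  congr 1
  rw [← Finset.sum_filter, Finset.sum_subtype (p := fun j : Fin n => ¬ p ≤ j.val) _ (by simp)]
  refine Finset.sum_congr rfl fun i _ => ?_
  simp [assemble, headPoint, i.2]

lemma indicator_pointPairing_gcst (hm : (fun j => (m j : ℝ)) ∈ P.carrier) {p : ℕ} (hp : p ≤ n)
    {s : ℝ} (hs : 0 < s) (τ : P.testSections) (q : Phase n) :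
    P.fundDomain.indicator (P.pointPairing (gcst p s (P.monomialSection m)) τ.1) q =
      ((Real.sqrt s ^ p * Real.exp (-s * hamiltonian p fun j => q.1 j - m j) : ℝ) : ℂ) *
        P.rescaledPairing m p τ.1 s⁻¹ q := by
  obtain ⟨C, hC⟩ := P.isPairedBy_gcst hm p hs.le
  by_cases hq : q ∈ P.fundDomain
  · rw [rescaledPairing, Set.indicator_of_mem hq, Set.indicator_of_mem hq,
      hC.eq τ.1 q (P.fundDomain_subset_openOrbit hq), P.density_rescale hp m hs hq.1]
    push_cast
    ring
  · rw [rescaledPairing, Set.indicator_of_notMem hq, Set.indicator_of_notMem hq, mul_zero]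

/-- The substitution `x_j = m_j + b_j / √s`, `j ≤ p`. -/
lemma sectionFunctional_gcst (hm : (fun j => (m j : ℝ)) ∈ P.carrier) {p : ℕ} (hp : p ≤ n)
    {s : ℝ} (hs : 0 < s) (τ : P.testSections) :
    P.sectionFunctional (gcst p s (P.monomialSection m)) τ =
      ∫ b : {j : Fin n // ¬ p ≤ j.val} → ℝ, (Real.exp (-(1 / 2) * ∑ i, b i ^ 2) : ℂ) *
        ∫ w, P.rescaledPairing m p τ.1 s⁻¹
          (assemble (headPoint m p + (Real.sqrt s)⁻¹ • b) w) := by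
  obtain ⟨C, hC⟩ := P.isPairedBy_gcst hm p hs.le
  have hint := hC.integrableOn (μ := MeasureTheory.volume) continuous_id
    P.volume_fundDomain_ne_top τ
  have hint' : MeasureTheory.Integrable
      (P.fundDomain.indicator (P.pointPairing (gcst p s (P.monomialSection m)) τ.1)) :=
    (MeasureTheory.integrable_indicator_iff P.measurableSet_fundDomain).2 hint
  have hS : 0 < Real.sqrt s := Real.sqrt_pos.2 hs
  set K : ({j : Fin n // ¬ p ≤ j.val} → ℝ) → ℂ := fun b =>
    (Real.exp (-s * ((1 / 2) * ∑ i, (b i - headPoint m p i) ^ 2)) : ℂ) *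
      ∫ w, P.rescaledPairing m p τ.1 s⁻¹ (assemble b w) with hK
  have h1 : P.sectionFunctional (gcst p s (P.monomialSection m)) τ =
      ((Real.sqrt s ^ p : ℝ) : ℂ) * ∫ b, K b := by
    rw [sectionFunctional, ← MeasureTheory.integral_indicator P.measurableSet_fundDomain,
      integral_assemble p hint', ← MeasureTheory.integral_const_mul]
    refine MeasureTheory.integral_congr_ae (Filter.Eventually.of_forall fun b => ?_)
    simp only [indicator_pointPairing_gcst hm hp hs, hamiltonian_assemble, hK]
    rw [MeasureTheory.integral_const_mul]
    push_cast
    ring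
  have h2 : ∫ b, K (headPoint m p + (Real.sqrt s)⁻¹ • b) =
      ((Real.sqrt s ^ p : ℝ) : ℂ) * ∫ b, K b := by
    have h3 := MeasureTheory.Measure.integral_comp_smul
      (MeasureTheory.volume : MeasureTheory.Measure ({j : Fin n // ¬ p ≤ j.val} → ℝ))
      (fun b => K (headPoint m p + b)) (Real.sqrt s)⁻¹
    rw [h3, MeasureTheory.integral_add_left_eq_self, Module.finrank_fintype_fun_eq_card,
      card_not_le hp, inv_pow, inv_inv, abs_of_pos (by positivity), Complex.real_smul]
  rw [h1, ← h2]
  refine MeasureTheory.integral_congr_ae (Filter.Eventually.of_forall fun b => ?_)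
  have h4 : -s * ((1 / 2) * ∑ i, ((headPoint m p + (Real.sqrt s)⁻¹ • b) i - headPoint m p i) ^ 2) =
      -(1 / 2) * ∑ i, b i ^ 2 := by
    simp only [Pi.add_apply, Pi.smul_apply, add_sub_cancel_left, smul_eq_mul, mul_pow, inv_pow,
      Real.sq_sqrt hs.le, ← Finset.mul_sum]
    field_simp
  simp only [hK, h4]

lemma limitFunctional_eq (hm : (fun j => (m j : ℝ)) ∈ P.carrier) {p : ℕ} (hp : p ≤ n)
    (τ : P.testSections) :
    P.limitFunctional p m τ = ∫ b : {j : Fin n // ¬ p ≤ j.val} → ℝ,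
      (Real.exp (-(1 / 2) * ∑ i, b i ^ 2) : ℂ) *
        ∫ w, P.rescaledPairing m p τ.1 0 (assemble (headPoint m p) w) := by
  obtain ⟨C, hC⟩ := P.isPairedBy_limitDensity hm p
  have hmeas : MeasurableSet (P.sliceDomain p fun j => (m j : ℝ)) :=
    (((continuous_glue p _).comp continuous_fst).prodMk continuous_snd).measurable
      P.measurableSet_fundDomain
  rw [MeasureTheory.integral_mul_const, integral_complex_ofReal, integral_gaussian_pi,
    card_not_le hp, limitFunctional, deltaFunctional, ← MeasureTheory.integral_indicator hmeas]
  congr 1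
  refine MeasureTheory.integral_congr_ae (Filter.Eventually.of_forall fun w => ?_)
  by_cases hw : assemble (headPoint m p) w ∈ P.fundDomain
  · have hw' : w ∈ P.sliceDomain p fun j => (m j : ℝ) := hw
    simp only
    rw [rescaledPairing, Set.indicator_of_mem hw, Set.indicator_of_mem hw']
    exact hC.eq τ.1 _ (P.fundDomain_subset_openOrbit hw)
  · have hw' : w ∉ P.sliceDomain p fun j => (m j : ℝ) := hw
    simp only
    rw [rescaledPairing, Set.indicator_of_notMem hw, Set.indicator_of_notMem hw']

end DelzantPolytope

theorem theorem4p2 {n d : ℕ} (P : DelzantPolytope n d) (p : ℕ) (hp : p ≤ n)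
    (m : Fin n → ℤ) (hm : (fun j => (m j : ℝ)) ∈ P.carrier) :
    -- the quantum operator acts on the monomial section by the eigenvalue `H(m)`
    (∀ q ∈ P.openOrbit, quantumOp p (P.monomialSection m).coeff q =
      (hamiltonian p (fun j => (m j : ℝ)) : ℂ) * (P.monomialSection m).coeff q) ∧
    -- the transform is well defined and gives distributional sections on `M`
    (∀ s : ℝ, 0 ≤ s →
      GCSTDefinedOn P.openOrbit p s (P.monomialSection m) ∧
      P.SectionIntegrable (gcst p s (P.monomialSection m)) ∧
      P.IsDistributionalSection (P.sectionFunctional (gcst p s (P.monomialSection m)))) ∧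
    -- the limit is a well-defined distributional section on `M`
    P.DeltaIntegrable p (fun j => (m j : ℝ)) (P.limitDensity p m) ∧
    P.IsDistributionalSection (P.limitFunctional p m) ∧
    -- convergence of the rescaled forms under the square root
    TendstoLocallyUniformlyOn
      (fun (s : ℝ) q => (s ^ p)⁻¹ • (gcst p s (P.monomialSection m)).form q)
      (P.dXdZ p) Filter.atTop P.openOrbit ∧
    -- convergence as distributional sections on `M`
    ∀ τ : P.testSections,
      Filter.Tendsto (fun s : ℝ => P.sectionFunctional (gcst p s (P.monomialSection m)) τ)
        Filter.atTop (nhds (P.limitFunctional p m τ)) := by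
  have hslice : Continuous fun v : ({j : Fin n // p ≤ j.val} → ℝ) × (Fin n → ℝ) =>
      ((DelzantPolytope.glue p (fun j => (m j : ℝ)) v.1, v.2) : Phase n) :=
    ((DelzantPolytope.continuous_glue p _).comp continuous_fst).prodMk continuous_snd
  obtain ⟨C, hC⟩ := P.isPairedBy_limitDensity hm p
  refine ⟨fun q hq => ?_, fun s hs => ⟨fun q hq => ⟨?_, ?_, ?_⟩, ?_, ?_⟩, ?_, ?_, ?_, fun τ => ?_⟩
  · have h := P.quantumOp_eqOn p m (P.monomialSection m).coeff _ (P.differentiableOn_amplitude m)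
      (fun q _ => by rw [P.monomialSection_coeff]) hq
    rw [h, P.monomialSection_coeff, fourierMode, fourierMode, mul_assoc]
  · exact (P.hasSum_quantumOp p m _ hq).summable
  · exact (P.hasSum_prequantumOp p m s hq).summable
  · exact (P.hasSum_lieDeriv p s hq).summable
  · obtain ⟨C, hC⟩ := P.isPairedBy_gcst hm p hs
    exact hC.integrableOn continuous_id P.volume_fundDomain_ne_top
  · obtain ⟨C, hC⟩ := P.isPairedBy_gcst hm p hs
    have h := hC.isDistributionalSection (μ := MeasureTheory.volume) continuous_id
      P.volume_fundDomain_ne_top 1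
    simp only [one_mul] at h
    exact h
  · exact hC.integrableOn hslice (P.volume_sliceDomain_ne_top p _)
  · exact hC.isDistributionalSection (μ := MeasureTheory.volume) hslice
      (P.volume_sliceDomain_ne_top p _) _
  · exact P.tendstoLocallyUniformlyOn_gcst_form hp m
  · rw [DelzantPolytope.limitFunctional_eq hm hp]
    refine (DelzantPolytope.tendsto_integral_gaussian_rescaledPairing hm p τ).congr' ?_
    filter_upwards [Filter.eventually_gt_atTop 0] with s hs
    exact (DelzantPolytope.sectionFunctional_gcst hm hp hs τ).symm
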